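/- Let $L,E,I,H,q,E_c,A_c,L_c>0$ and let the sag-span ratio $n$ be given by $\frac{q}{H}=\frac{8n}{L}$. Let $p\in L^1[0,L]$ with $p\ge 0$ a.e. Consider the Melan equation $$EI\,w''''-\Big(H+\frac{E_cA_c}{L_c}\frac{q}{H}\int_0^L w\,dx\Big)w''+\frac{q^2}{H^2}\frac{E_cA_c}{L_c}\int_0^L w\,dx=p(x)\quad\text{for a.e. }x\in(0,L),\qquad(1)$$ $$w(0)=w(L)=w''(0)=w''(L)=0.\qquad(2)$$ A solution is a function $w\in W^{4,1}[0,L]$ satisfying (1), (2); a lower (upper) solution is a function $w\in W^{4,1}[0,L]$ satisfying (2) and (1) with "$=$" replaced by "$\le$" ("$\ge$"). Put $\beta(x)=\frac{L}{100}\sin\frac{\pi x}{L}$, $$[0,\beta]=\{u\in C^2[0,L]:\ 0\le u\le\beta,\ 0\ge u''\ge\beta''\text{ on }[0,L]\},$$ $$a=\frac{H}{EI},\quad b=\frac qH\frac{E_cA_c}{EI}\frac1{L_c},\quad c=\Big(\frac qH\Big)^2\frac{E_cA_c}{EI}\frac1{L_c},\quad \lambda=\frac{L}{100},$$ $$M=a+\frac{cL^3}{400n\pi}\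 \Big(=a+2b\lambda\frac L\pi\Big),\qquad N=c\Big(1+\frac{\pi^2}{800n}\Big)\ \Big(=c+b\lambda\frac{\pi^2}{L^2}\Big),\qquad \sigma(x)=\frac{3x^3}{6x\cosh x+6x-12\sinh x-x^3}.$$ Theorem 6.1. Assume that for a.e. $x\in(0,L)$ $$p(x)\le\Big[\frac{\pi^4}{100L^3}EI+\frac{H\pi^2}{100L}+\frac qH\frac{E_cA_c}{L_c}\frac{\pi L}{5000}\Big]\sin\frac{\pi x}{L}+2\Big(\frac qH\Big)^2\frac{E_cA_c}{L_c}\frac{L^2}{100\pi}.$$ Then $0$ is a lower solution and $\beta$ is an upper solution of (1), (2). If, moreover, $n\ge\frac1{15.32}$, $p$ is not a.e. equal to $0$, and $$N\le\frac{4M}{L^3}\,\sigma(\sqrt M L),$$ then (1), (2) has exactly one solution $y$ in $[0,\beta]$, and $y>0$ on $(0,L)$. The iterative procedure $$y_k''''-\Big(a+2b\lambda\frac L\pi\Big)y_k''+\Big(c+b\lambda\frac{\pi^2}{L^2}\Big)\int_0^L y_k =\frac{p}{EI}+b\,y_{k-1}''\int_0^L y_{k-1}-2b\lambda\frac L\pi\,y_{k-1}''+b\lambda\frac{\pi^2}{L^2}\int_0^L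 y_{k-1},$$ $y_k\in W^{4,1}[0,L]$, $y_k(0)=y_k(L)=y_k''(0)=y_k''(L)=0$ ($k\ge1$), with initial function $y_0=0$, respectively $y_0=\beta$, determines unique sequences $(\alpha_k)$, respectively $(\beta_k)$. On $[0,L]$ they satisfy $\alpha_k\le\alpha_{k+1}$, $\alpha_k\le\beta_k$, $\beta_{k+1}\le\beta_k$ and $\alpha_k''\ge\alpha_{k+1}''$, $\alpha_k''\ge\beta_k''$, $\beta_{k+1}''\ge\beta_k''$ for all $k\ge0$, and both converge to $y$ uniformly on $[0,L]$. -/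

import Mathlib

/-- The data of a suspension bridge: main span `L`, elastic modulus `E` and moment of inertia `I`
of the deck, horizontal cable tension `H` under the dead load `q`, and elastic modulus `Ec`,
cross-sectional area `Ac` and length `Lc` of the cable. -/
structure Bridge where
  (L E I H q Ec Ac Lc : ℝ)
  L_pos : 0 < L
  E_pos : 0 < E
  I_pos : 0 < I
  H_pos : 0 < H
  q_pos : 0 < q
  Ec_pos : 0 < Ec
  Ac_pos : 0 < Ac
  Lc_pos : 0 < Lc

/-- The `k`-th derivative on the closed interval `[0, L]` (one-sided at the end points).
Functions on `[0, L]` are represented by functions `ℝ → ℝ`; only their values on `[0, L]` matter. -/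
noncomputable def derivOn (L : ℝ) (k : ℕ) (u : ℝ → ℝ) : ℝ → ℝ :=
  iteratedDerivWithin k u (Set.Icc 0 L)

/-- `u ∈ W^{4,1}[0, L]`, given by its continuous representative: `u` is `C³` on `[0, L]` and its
third derivative is absolutely continuous there. The fourth derivative `derivOn L 4 u` then
exists almost everywhere and is integrable. -/
def IsW41 (L : ℝ) (u : ℝ → ℝ) : Prop :=
  ContDiffOn ℝ 3 u (Set.Icc 0 L) ∧ AbsolutelyContinuousOnInterval (derivOn L 3 u) 0 L

/-- The hinged (Navier) boundary conditions `u(0) = u(L) = u''(0) = u''(L) = 0`. -/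
def NavierBC (L : ℝ) (u : ℝ → ℝ) : Prop :=
  u 0 = 0 ∧ u L = 0 ∧ derivOn L 2 u 0 = 0 ∧ derivOn L 2 u L = 0

/-- The function `σ`. -/
noncomputable def melanSigma (x : ℝ) : ℝ :=
  3 * x ^ 3 / (6 * x * Real.cosh x + 6 * x - 12 * Real.sinh x - x ^ 3)

/-- The sector `[α, β]`: the `C²` functions `u` on `[0, L]` with `α ≤ u ≤ β` and
`α'' ≥ u'' ≥ β''` on `[0, L]`. -/
def sector (L : ℝ) (α β : ℝ → ℝ) : Set (ℝ → ℝ) :=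
  {u | ContDiffOn ℝ 2 u (Set.Icc 0 L) ∧
    ∀ x ∈ Set.Icc 0 L, α x ≤ u x ∧ u x ≤ β x ∧
      derivOn L 2 u x ≤ derivOn L 2 α x ∧ derivOn L 2 β x ≤ derivOn L 2 u x}

namespace Bridge

/-- The left-hand side of the Melan equation,
`EI w'''' - (H + (E_c A_c / L_c) (q / H) ∫₀ᴸ w) w'' + (q² / H²) (E_c A_c / L_c) ∫₀ᴸ w`. -/
noncomputable def melanLHS (B : Bridge) (w : ℝ → ℝ) (x : ℝ) : ℝ :=
  B.E * B.I * derivOn B.L 4 w x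
    - (B.H + B.Ec * B.Ac / B.Lc * (B.q / B.H) * ∫ t in (0 : ℝ)..B.L, w t) * derivOn B.L 2 w x
    + B.q ^ 2 / B.H ^ 2 * (B.Ec * B.Ac / B.Lc) * ∫ t in (0 : ℝ)..B.L, w t

/-- `w` solves the Melan boundary value problem with live load `p`. -/
def IsSolution (B : Bridge) (p w : ℝ → ℝ) : Prop :=
  IsW41 B.L w ∧ NavierBC B.L w ∧
    ∀ᵐ x ∂(MeasureTheory.volume.restrict (Set.Ioo 0 B.L)), B.melanLHS w x = p x

/-- `w` is a lower solution of the Melan boundary value problem with live load `p`. -/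
def IsLowerSolution (B : Bridge) (p w : ℝ → ℝ) : Prop :=
  IsW41 B.L w ∧ NavierBC B.L w ∧
    ∀ᵐ x ∂(MeasureTheory.volume.restrict (Set.Ioo 0 B.L)), B.melanLHS w x ≤ p x

/-- `w` is an upper solution of the Melan boundary value problem with live load `p`. -/
def IsUpperSolution (B : Bridge) (p w : ℝ → ℝ) : Prop :=
  IsW41 B.L w ∧ NavierBC B.L w ∧
    ∀ᵐ x ∂(MeasureTheory.volume.restrict (Set.Ioo 0 B.L)), p x ≤ B.melanLHS w x

/-- The coefficient `a` of the equation divided by `EI`. -/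
noncomputable def a (B : Bridge) : ℝ := B.H / (B.E * B.I)

/-- The coefficient `b` of the equation divided by `EI`. -/
noncomputable def b (B : Bridge) : ℝ := B.q / B.H * (B.Ec * B.Ac / (B.E * B.I)) * (1 / B.Lc)

/-- The coefficient `c` of the equation divided by `EI`. -/
noncomputable def c (B : Bridge) : ℝ :=
  (B.q / B.H) ^ 2 * (B.Ec * B.Ac / (B.E * B.I)) * (1 / B.Lc)

/-- The amplitude `λ = L / 100`. -/
noncomputable def lam (B : Bridge) : ℝ := B.L / 100

/-- The function `(L / 100) sin (π x / L)`. -/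
noncomputable def beta (B : Bridge) (x : ℝ) : ℝ := B.lam * Real.sin (Real.pi / B.L * x)

/-- `v` is obtained from `u` by one step of the iteration: `v ∈ W^{4,1}[0, L]` satisfies the
boundary conditions and
`v'''' - (a + 2bλL/π) v'' + (c + bλπ²/L²) ∫₀ᴸ v
  = p/(EI) + b u'' ∫₀ᴸ u - (2bλL/π) u'' + (bλπ²/L²) ∫₀ᴸ u`. -/
def IsStep (B : Bridge) (p u v : ℝ → ℝ) : Prop :=
  IsW41 B.L v ∧ NavierBC B.L v ∧
    ∀ᵐ x ∂(MeasureTheory.volume.restrict (Set.Ioo 0 B.L)),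
      derivOn B.L 4 v x
          - (B.a + 2 * B.b * B.lam * (B.L / Real.pi)) * derivOn B.L 2 v x
          + (B.c + B.b * B.lam * (Real.pi ^ 2 / B.L ^ 2)) * ∫ t in (0 : ℝ)..B.L, v t
        = p x / (B.E * B.I)
          + B.b * derivOn B.L 2 u x * (∫ t in (0 : ℝ)..B.L, u t)
          - 2 * B.b * B.lam * (B.L / Real.pi) * derivOn B.L 2 u x
          + B.b * B.lam * (Real.pi ^ 2 / B.L ^ 2) * ∫ t in (0 : ℝ)..B.L, u t

/-- `y` is a sequence of iterates starting at `y₀`. -/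
def IsIteration (B : Bridge) (p y₀ : ℝ → ℝ) (y : ℕ → ℝ → ℝ) : Prop :=
  Set.EqOn (y 0) y₀ (Set.Icc 0 B.L) ∧ ∀ k, B.IsStep p (y k) (y (k + 1))

/-- `y` is the sequence of iterates starting at `y₀`: it is one, and every other one has the
same values on `[0, L]`. -/
def IsTheIteration (B : Bridge) (p y₀ : ℝ → ℝ) (y : ℕ → ℝ → ℝ) : Prop :=
  B.IsIteration p y₀ y ∧
    ∀ z, B.IsIteration p y₀ z → ∀ k, Set.EqOn (z k) (y k) (Set.Icc 0 B.L)

end Bridge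

/-! Write `R` for `dirichletInv L`, the inverse of `-d²/dx²` with zero boundary values. A function
`u ∈ W^{4,1}` with hinged ends is `R (R h)` with `h = u''''` integrable and `-u'' = R h`, so every
fourth order question becomes one about `v = R h` (`exists_dirichletInv_of_isW41`).

The core is a maximum principle for `u'''' - m² u'' + N ∫ u = f ≥ 0` with `m = √M`, concluding `-u''
≥ 0` (`dirichletInv_nonneg_of_nonlocal`). The integral term enters with the unfavourable sign: `-v''
+ m² v = f - N J` with `J = ∫ u`. Testing with the solution `ψ` of `-ψ'' + m² ψ = s (L - s) / 2`
gives `(1 + N ∫ ψ) J = ∫ ψ f`, so `J` is known in terms of `f`. The bound `ψ ≤ κ sinh (m s)` and its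
mirror image compare `∫ ψ f` with the integrals of `f` in the Green representation of `v`; the loss
is absorbed under the assumed inequality between `N` and `σ`.

The coefficients added to both sides of the iteration are chosen so that its right-hand side is
monotone on the sector `[0, β]` for the order `u ≤ v`, `u'' ≥ v''` (`stepRHS_mono`). Together with
comparison, this makes the sector invariant and the sequences from `0` and `β` monotone. Their
second derivatives are monotone and bounded, hence converge pointwise; dominated convergence through
`R` turns this into uniform convergence of the iterates to a solution
(`exists_solution_of_tendsto`).

Both limits coincide because solutions in the sector are unique: a smaller integral forces a
pointwise larger solution (`IsSolution.le_of_integral_le`), so the integrals agree. Positivity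
follows from concavity. -/

open MeasureTheory Set Filter Topology intervalIntegral

/-! ### The inverse of the Dirichlet problem `-v'' = g` -/

/-- The solution `v` of `-v'' = g`, `v 0 = v L = 0`. -/
noncomputable def dirichletInv (L : ℝ) (g : ℝ → ℝ) (x : ℝ) : ℝ :=
  x / L * (∫ t in (0 : ℝ)..L, ∫ s in (0 : ℝ)..t, g s) - ∫ t in (0 : ℝ)..x, ∫ s in (0 : ℝ)..t, g s

/-- The derivative of `dirichletInv L g`. -/
noncomputable def dirichletInvDeriv (L : ℝ) (g : ℝ → ℝ) (x : ℝ) : ℝ :=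
  (∫ t in (0 : ℝ)..L, ∫ s in (0 : ℝ)..t, g s) / L - ∫ s in (0 : ℝ)..x, g s

lemma MeasureTheory.LocallyIntegrable.intervalIntegrable {g : ℝ → ℝ} (hg : LocallyIntegrable g)
    {a b : ℝ} : IntervalIntegrable g volume a b :=
  (hg.integrableOn_isCompact isCompact_uIcc).intervalIntegrable

lemma continuous_primitive_of_locallyIntegrable {g : ℝ → ℝ} (hg : LocallyIntegrable g) :
    Continuous fun x => ∫ s in (0 : ℝ)..x, g s :=
  continuous_primitive (fun _ _ => hg.intervalIntegrable) 0

lemma continuous_dirichletInvDeriv (L : ℝ) {g : ℝ → ℝ} (hg : LocallyIntegrable g) :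
    Continuous (dirichletInvDeriv L g) :=
  continuous_const.sub (continuous_primitive_of_locallyIntegrable hg)

lemma hasDerivAt_dirichletInv (L : ℝ) {g : ℝ → ℝ} (hg : LocallyIntegrable g) (x : ℝ) :
    HasDerivAt (dirichletInv L g) (dirichletInvDeriv L g x) x := by
  have hc := continuous_primitive_of_locallyIntegrable hg
  have h1 : HasDerivAt (fun x => ∫ t in (0 : ℝ)..x, ∫ s in (0 : ℝ)..t, g s)
      (∫ s in (0 : ℝ)..x, g s) x :=
    integral_hasDerivAt_right (hc.intervalIntegrable _ _)
      (hc.stronglyMeasurableAtFilter _ _) hc.continuousAt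
  have h2 := (((hasDerivAt_id x).div_const L).mul_const
    (∫ t in (0 : ℝ)..L, ∫ s in (0 : ℝ)..t, g s)).sub h1
  refine h2.congr_deriv ?_
  rw [dirichletInvDeriv]; ring

lemma continuous_dirichletInv (L : ℝ) {g : ℝ → ℝ} (hg : LocallyIntegrable g) :
    Continuous (dirichletInv L g) :=
  continuous_iff_continuousAt.2 fun x => (hasDerivAt_dirichletInv L hg x).continuousAt

lemma dirichletInv_zero_left (L : ℝ) (g : ℝ → ℝ) : dirichletInv L g 0 = 0 := by
  simp [dirichletInv]

lemma dirichletInv_zero_right {L : ℝ} (hL : 0 < L) (g : ℝ → ℝ) : dirichletInv L g L = 0 := by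
  simp [dirichletInv, hL.ne']

lemma primitive_congr_ae {L : ℝ} {f g : ℝ → ℝ}
    (h : ∀ᵐ x ∂(volume.restrict (Ioo 0 L)), f x = g x) {x : ℝ} (hx : x ∈ Icc 0 L) :
    ∫ s in (0 : ℝ)..x, f s = ∫ s in (0 : ℝ)..x, g s := by
  apply intervalIntegral.integral_congr_ae
  rw [ae_restrict_iff' measurableSet_Ioo] at h
  have h2 : ∀ᵐ x : ℝ, x ≠ L := by simp [ae_iff, measure_singleton]
  filter_upwards [h, h2] with s hs hs2 hs3
  rw [uIoc_of_le hx.1] at hs3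
  exact hs ⟨hs3.1, lt_of_le_of_ne (hs3.2.trans hx.2) hs2⟩

lemma dirichletInv_congr_ae {L : ℝ} {f g : ℝ → ℝ}
    (h : ∀ᵐ x ∂(volume.restrict (Ioo 0 L)), f x = g x) {x : ℝ} (hx : x ∈ Icc 0 L) :
    dirichletInv L f x = dirichletInv L g x := by
  have hx0 : (0 : ℝ) ≤ L := hx.1.trans hx.2
  have key : ∀ y ∈ Icc 0 L, ∫ t in (0 : ℝ)..y, ∫ s in (0 : ℝ)..t, f s =
      ∫ t in (0 : ℝ)..y, ∫ s in (0 : ℝ)..t, g s := by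
    intro y hy
    apply intervalIntegral.integral_congr
    intro t ht
    rw [uIcc_of_le hy.1] at ht
    exact primitive_congr_ae h ⟨ht.1, ht.2.trans hy.2⟩
  rw [dirichletInv, dirichletInv, key x hx, key L ⟨hx0, le_rfl⟩]

lemma dirichletInv_congr {L : ℝ} {f g : ℝ → ℝ}
    (h : EqOn f g (Icc 0 L)) {x : ℝ} (hx : x ∈ Icc 0 L) :
    dirichletInv L f x = dirichletInv L g x :=
  dirichletInv_congr_ae ((ae_restrict_iff' measurableSet_Ioo).2
    (Eventually.of_forall fun _ hy => h (Ioo_subset_Icc_self hy))) hx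

lemma dirichletInv_sub (L : ℝ) {f g : ℝ → ℝ} (hf : LocallyIntegrable f)
    (hg : LocallyIntegrable g) (x : ℝ) :
    dirichletInv L (fun s => f s - g s) x = dirichletInv L f x - dirichletInv L g x := by
  have key : ∀ y, ∫ t in (0 : ℝ)..y, ∫ s in (0 : ℝ)..t, (f s - g s) =
      (∫ t in (0 : ℝ)..y, ∫ s in (0 : ℝ)..t, f s) - ∫ t in (0 : ℝ)..y, ∫ s in (0 : ℝ)..t, g s := by
    intro y
    rw [← intervalIntegral.integral_sub
      ((continuous_primitive_of_locallyIntegrable hf).intervalIntegrable _ _)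
      ((continuous_primitive_of_locallyIntegrable hg).intervalIntegrable _ _)]
    congr 1; ext t
    exact intervalIntegral.integral_sub hf.intervalIntegrable hg.intervalIntegrable
  simp only [dirichletInv, key]; ring

lemma dirichletInv_const_mul (L c : ℝ) (g : ℝ → ℝ) (x : ℝ) :
    dirichletInv L (fun s => c * g s) x = c * dirichletInv L g x := by
  simp only [dirichletInv, intervalIntegral.integral_const_mul]; ring

lemma concaveOn_dirichletInv {L : ℝ} {g : ℝ → ℝ} (hg : LocallyIntegrable g)
    (h : ∀ x ∈ Icc 0 L, 0 ≤ g x) : ConcaveOn ℝ (Icc 0 L) (dirichletInv L g) := by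
  apply AntitoneOn.concaveOn_of_deriv (convex_Icc 0 L) (continuous_dirichletInv L hg).continuousOn
  · exact fun x _ => (hasDerivAt_dirichletInv L hg x).differentiableAt.differentiableWithinAt
  · rw [interior_Icc]
    intro x hx y hy hxy
    rw [(hasDerivAt_dirichletInv L hg x).deriv, (hasDerivAt_dirichletInv L hg y).deriv,
      dirichletInvDeriv, dirichletInvDeriv]
    have h1 := intervalIntegral.integral_nonneg (μ := volume) hxy
      (fun s hs => h s ⟨hx.1.le.trans hs.1, hs.2.trans hy.2.le⟩)
    have h2 := intervalIntegral.integral_add_adjacent_intervals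
      (hg.intervalIntegrable (a := 0) (b := x)) (hg.intervalIntegrable (a := x) (b := y))
    linarith

lemma dirichletInv_nonneg {L : ℝ} {g : ℝ → ℝ} (hg : LocallyIntegrable g)
    (h : ∀ x ∈ Icc 0 L, 0 ≤ g x) {x : ℝ} (hx : x ∈ Icc 0 L) :
    0 ≤ dirichletInv L g x := by
  rcases (hx.1.trans hx.2).eq_or_lt with rfl | hL
  · rw [show x = 0 from le_antisymm hx.2 hx.1, dirichletInv_zero_left]
  have := (concaveOn_dirichletInv hg h).min_le_of_mem_Icc (left_mem_Icc.2 hL.le)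
    (right_mem_Icc.2 hL.le) hx
  simpa [dirichletInv_zero_left, dirichletInv_zero_right hL] using this

/-- Green's formula on `[a, b]` for `v = dirichletInv L g` and a test function `θ`. -/
lemma green_formula (L : ℝ) {g θ θ' θ'' : ℝ → ℝ} (hg : LocallyIntegrable g)
    (h1 : ∀ x, HasDerivAt θ (θ' x) x) (h2 : ∀ x, HasDerivAt θ' (θ'' x) x) (h3 : Continuous θ'')
    (a b : ℝ) :
    ∫ s in a..b, (θ s * g s + θ'' s * dirichletInv L g s) =
      (θ' b * dirichletInv L g b - θ b * dirichletInvDeriv L g b) -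
      (θ' a * dirichletInv L g a - θ a * dirichletInvDeriv L g a) := by
  have ac : ∀ {f f' : ℝ → ℝ}, (∀ x, HasDerivAt f (f' x) x) → Continuous f' →
      AbsolutelyContinuousOnInterval f a b := by
    intro f f' hf hf'
    refine (contDiff_one_iff_deriv.2
      ⟨fun x => (hf x).differentiableAt, ?_⟩).contDiffOn.absolutelyContinuousOnInterval
    rwa [show deriv f = f' from funext fun x => (hf x).deriv]
  have hθ' : Continuous θ' := continuous_iff_continuousAt.2 fun x => (h2 x).continuousAt
  -- As `g` is only locally integrable, this function has derivative `-g` merely almost everywhere;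
  -- absolute continuity keeps the fundamental theorem of calculus available.
  have acd : AbsolutelyContinuousOnInterval (dirichletInvDeriv L g) a b := by
    have : dirichletInvDeriv L g = fun x => dirichletInvDeriv L g a - ∫ s in a..x, g s := by
      ext x
      have := intervalIntegral.integral_add_adjacent_intervals
        (hg.intervalIntegrable (a := 0) (b := a)) (hg.intervalIntegrable (a := a) (b := x))
      simp only [dirichletInvDeriv]; linarith
    rw [this]
    exact (ac (fun x => hasDerivAt_const x _) continuous_const).fun_sub
      (hg.intervalIntegrable.absolutelyContinuousOnInterval_intervalIntegral left_mem_uIcc)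
  have acT := ((ac h2 h3).fun_mul (ac (hasDerivAt_dirichletInv L hg)
    (continuous_dirichletInvDeriv L hg))).fun_sub ((ac h1 hθ').fun_mul acd)
  rw [← acT.integral_deriv_eq_sub]
  apply intervalIntegral.integral_congr_ae
  filter_upwards [LocallyIntegrable.ae_hasDerivAt_integral hg] with x hx _
  have hd : HasDerivAt (dirichletInvDeriv L g) (- g x) x := by
    exact (hx 0).const_sub ((∫ t in (0 : ℝ)..L, ∫ s in (0 : ℝ)..t, g s) / L)
  have := ((h2 x).mul (hasDerivAt_dirichletInv L hg x)).sub ((h1 x).mul hd)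
  refine (HasDerivAt.deriv (this.congr_deriv ?_)).symm
  ring

/-- A function with given second derivative and zero boundary values. -/
lemma eq_dirichletInv {L d0 : ℝ} (hL : 0 < L) {g v d : ℝ → ℝ} (hg : LocallyIntegrable g)
    (hv : ContinuousOn v (Icc 0 L)) (hvd : ∀ x ∈ Ioo 0 L, HasDerivAt v (d x) x)
    (hd : ∀ x ∈ Icc 0 L, d x = d0 - ∫ s in (0 : ℝ)..x, g s) (h0 : v 0 = 0) (h1 : v L = 0) :
    EqOn v (dirichletInv L g) (Icc 0 L) := by
  have hc := continuous_primitive_of_locallyIntegrable hg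
  have key : ∀ x ∈ Icc 0 L, v x = d0 * x - ∫ t in (0 : ℝ)..x, ∫ s in (0 : ℝ)..t, g s := by
    intro x hx
    have := integral_eq_sub_of_hasDerivAt_of_le hx.1 (hv.mono (Icc_subset_Icc_right hx.2))
      (f' := fun x => d0 - ∫ s in (0 : ℝ)..x, g s)
      (fun y hy => by
        rw [← hd y ⟨hy.1.le, hy.2.le.trans hx.2⟩]
        exact hvd y ⟨hy.1, hy.2.trans_le hx.2⟩)
      ((continuous_const.sub hc).intervalIntegrable _ _)
    rw [intervalIntegral.integral_sub (continuous_const.intervalIntegrable _ _)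
      (hc.intervalIntegrable _ _)] at this
    simp [h0] at this
    linarith
  intro x hx
  -- The unknown initial slope `d0` is forced by the boundary value at `L`.
  have hkL := key L ⟨hL.le, le_rfl⟩
  rw [h1] at hkL
  rw [key x hx, dirichletInv, show (∫ t in (0 : ℝ)..L, ∫ s in (0 : ℝ)..t, g s) = d0 * L by linarith]
  field_simp

/-! ### Hinged `W^{4,1}` functions as double Dirichlet inverses -/

lemma AbsolutelyContinuousOnInterval.congr {f g : ℝ → ℝ} {a b : ℝ}
    (hf : AbsolutelyContinuousOnInterval f a b) (h : EqOn f g (uIcc a b)) :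
    AbsolutelyContinuousOnInterval g a b := by
  rw [absolutelyContinuousOnInterval_iff] at hf ⊢
  intro ε hε
  obtain ⟨δ, hδ, H⟩ := hf ε hε
  refine ⟨δ, hδ, fun E hE hs => ?_⟩
  have := H E hE hs
  rwa [Finset.sum_congr rfl fun i hi => by rw [h (hE.1 i hi).1, h (hE.1 i hi).2]] at this

lemma derivOn_congr {L : ℝ} {f g : ℝ → ℝ} (h : EqOn f g (Icc 0 L)) (k : ℕ) :
    EqOn (derivOn L k f) (derivOn L k g) (Icc 0 L) :=
  iteratedDerivWithin_congr h

lemma derivOn_succ_of_hasDerivAt {L : ℝ} (hL : 0 < L) {k : ℕ} {f g : ℝ → ℝ} {g' x : ℝ}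
    (hx : x ∈ Icc 0 L) (hfg : EqOn (derivOn L k f) g (Icc 0 L)) (hg : HasDerivAt g g' x) :
    derivOn L (k + 1) f x = g' := by
  rw [derivOn, iteratedDerivWithin_succ]
  change derivWithin (derivOn L k f) (Icc 0 L) x = g'
  rw [derivWithin_congr hfg (hfg hx)]
  exact hg.hasDerivWithinAt.derivWithin (uniqueDiffOn_Icc hL x hx)

lemma deriv_dirichletInv (L : ℝ) {g : ℝ → ℝ} (hg : LocallyIntegrable g) :
    deriv (dirichletInv L g) = dirichletInvDeriv L g :=
  funext fun x => (hasDerivAt_dirichletInv L hg x).deriv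

lemma hasDerivAt_dirichletInvDeriv (L : ℝ) {g : ℝ → ℝ} (hg : Continuous g) (x : ℝ) :
    HasDerivAt (dirichletInvDeriv L g) (- g x) x :=
  (integral_hasDerivAt_right (hg.intervalIntegrable _ _)
      (hg.stronglyMeasurableAtFilter _ _) hg.continuousAt).const_sub _

/-- The double Dirichlet inverse of a locally integrable function. -/
lemma contDiff_dirichletInv_dirichletInv (L : ℝ) {h : ℝ → ℝ} (hh : LocallyIntegrable h) :
    ContDiff ℝ 3 (dirichletInv L (dirichletInv L h)) := by
  have hc := continuous_dirichletInv L hh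
  have h1 : ContDiff ℝ 1 (dirichletInv L h) :=
    contDiff_one_iff_deriv.2 ⟨fun x => (hasDerivAt_dirichletInv L hh x).differentiableAt, by
      rw [deriv_dirichletInv L hh]; exact continuous_dirichletInvDeriv L hh⟩
  have h2 : ContDiff ℝ 2 (dirichletInvDeriv L (dirichletInv L h)) := by
    rw [show (2 : WithTop ℕ∞) = 1 + 1 by norm_num, contDiff_succ_iff_deriv]
    refine ⟨fun x => (hasDerivAt_dirichletInvDeriv L hc x).differentiableAt, by simp, ?_⟩
    rw [show deriv (dirichletInvDeriv L (dirichletInv L h)) = fun x => - dirichletInv L h x from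
      funext fun x => (hasDerivAt_dirichletInvDeriv L hc x).deriv]
    exact h1.neg
  rw [show (3 : WithTop ℕ∞) = 2 + 1 by norm_num, contDiff_succ_iff_deriv]
  refine ⟨fun x => (hasDerivAt_dirichletInv L hc.locallyIntegrable x).differentiableAt, by simp, ?_⟩
  rwa [deriv_dirichletInv L hc.locallyIntegrable]

lemma derivOn_two_dirichletInv {L : ℝ} (hL : 0 < L) {h : ℝ → ℝ} (hh : Continuous h) :
    EqOn (derivOn L 2 (dirichletInv L h)) (fun x => - h x) (Icc 0 L) := by
  have h0 : EqOn (derivOn L 0 (dirichletInv L h)) (dirichletInv L h) (Icc 0 L) := by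
    intro x _; simp [derivOn]
  have h1 : EqOn (derivOn L 1 (dirichletInv L h)) (dirichletInvDeriv L h) (Icc 0 L) :=
    fun x hx => derivOn_succ_of_hasDerivAt hL hx h0
      (hasDerivAt_dirichletInv L hh.locallyIntegrable x)
  exact fun x hx => derivOn_succ_of_hasDerivAt hL hx h1 (hasDerivAt_dirichletInvDeriv L hh x)

lemma derivOn_three_dirichletInv_dirichletInv {L : ℝ} (hL : 0 < L) {h : ℝ → ℝ}
    (hh : LocallyIntegrable h) :
    EqOn (derivOn L 3 (dirichletInv L (dirichletInv L h))) (fun x => - dirichletInvDeriv L h x)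
      (Icc 0 L) :=
  fun x hx => derivOn_succ_of_hasDerivAt hL hx
    (derivOn_two_dirichletInv hL (continuous_dirichletInv L hh))
    (hasDerivAt_dirichletInv L hh x).neg

lemma derivOn_four_dirichletInv_dirichletInv {L : ℝ} (hL : 0 < L) {h : ℝ → ℝ}
    (hh : LocallyIntegrable h) :
    ∀ᵐ x ∂(volume.restrict (Ioo 0 L)),
      derivOn L 4 (dirichletInv L (dirichletInv L h)) x = h x := by
  rw [ae_restrict_iff' measurableSet_Ioo]
  filter_upwards [LocallyIntegrable.ae_hasDerivAt_integral hh] with x hx hxI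
  refine derivOn_succ_of_hasDerivAt hL (Ioo_subset_Icc_self hxI)
    (derivOn_three_dirichletInv_dirichletInv hL hh) ?_
  have := ((hx 0).const_sub ((∫ t in (0 : ℝ)..L, ∫ s in (0 : ℝ)..t, h s) / L)).neg
  rw [neg_neg] at this
  exact this

lemma isW41_dirichletInv_dirichletInv {L : ℝ} (hL : 0 < L) {h : ℝ → ℝ}
    (hh : LocallyIntegrable h) : IsW41 L (dirichletInv L (dirichletInv L h)) := by
  refine ⟨(contDiff_dirichletInv_dirichletInv L hh).contDiffOn, ?_⟩
  have h1 : AbsolutelyContinuousOnInterval (fun x => - dirichletInvDeriv L h x) 0 L :=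
    ((contDiff_const (c := (∫ t in (0 : ℝ)..L, ∫ s in (0 : ℝ)..t, h s) / L)
      ).contDiffOn.absolutelyContinuousOnInterval.fun_sub
      (hh.intervalIntegrable.absolutelyContinuousOnInterval_intervalIntegral left_mem_uIcc)).fun_neg
  refine h1.congr ?_
  rw [uIcc_of_le hL.le]
  exact (derivOn_three_dirichletInv_dirichletInv hL hh).symm

lemma navierBC_dirichletInv_dirichletInv {L : ℝ} (hL : 0 < L) {h : ℝ → ℝ}
    (hh : LocallyIntegrable h) : NavierBC L (dirichletInv L (dirichletInv L h)) := by
  have h2 := derivOn_two_dirichletInv hL (continuous_dirichletInv L hh)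
  refine ⟨dirichletInv_zero_left _ _, dirichletInv_zero_right hL _, ?_, ?_⟩
  · simp [h2 (left_mem_Icc.2 hL.le), dirichletInv_zero_left]
  · simp [h2 (right_mem_Icc.2 hL.le), dirichletInv_zero_right hL]

lemma hasDerivAt_derivOn {L : ℝ} {k : ℕ} {u : ℝ → ℝ} {x : ℝ} (hx : x ∈ Ioo 0 L)
    (hu : DifferentiableWithinAt ℝ (derivOn L k u) (Icc 0 L) x) :
    HasDerivAt (derivOn L k u) (derivOn L (k + 1) u x) x := by
  have hn : Icc 0 L ∈ 𝓝 x := Icc_mem_nhds hx.1 hx.2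
  have := hu.hasDerivWithinAt.hasDerivAt hn
  rwa [show derivOn L (k + 1) u x = derivWithin (derivOn L k u) (Icc 0 L) x by
    rw [derivOn, iteratedDerivWithin_succ]; rfl]

/-- Integrate the fourth derivative back up. The boundary conditions on `u''` fix the constants in
the first two integrations, those on `u` the constants in the last two. This reduces all later
arguments to the locally integrable function `h`. -/
lemma exists_dirichletInv_of_isW41 {L : ℝ} (hL : 0 < L) {u : ℝ → ℝ} (hu : IsW41 L u)
    (bc : NavierBC L u) :
    ∃ h, LocallyIntegrable h ∧ EqOn u (dirichletInv L (dirichletInv L h)) (Icc 0 L) ∧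
      EqOn (derivOn L 2 u) (fun x => - dirichletInv L h x) (Icc 0 L) ∧
      ∀ᵐ x ∂(volume.restrict (Ioo 0 L)), derivOn L 4 u x = h x := by
  obtain ⟨hC, hAC⟩ := hu
  have hud := uniqueDiffOn_Icc hL
  have hdw : ∀ x ∈ Ioo 0 L, derivOn L 4 u x = deriv (derivOn L 3 u) x := by
    intro x hx
    rw [derivOn, iteratedDerivWithin_succ, derivWithin_of_mem_nhds (Icc_mem_nhds hx.1 hx.2)]; rfl
  have hcont : ∀ k : ℕ, k ≤ 3 → ContinuousOn (derivOn L k u) (Icc 0 L) := fun k hk =>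
    hC.continuousOn_iteratedDerivWithin (by exact_mod_cast hk) hud
  have hder : ∀ k : ℕ, k < 3 → ∀ x ∈ Ioo 0 L,
      HasDerivAt (derivOn L k u) (derivOn L (k + 1) u x) x := fun k hk x hx =>
    hasDerivAt_derivOn hx
      (hC.differentiableOn_iteratedDerivWithin (by exact_mod_cast hk) hud x
        (Ioo_subset_Icc_self hx))
  -- The cut-off makes `h` integrable on the whole line, as the lemmas on `dirichletInv` require.
  set h : ℝ → ℝ := (Ioo 0 L).indicator (deriv (derivOn L 3 u)) with hdef
  have hae : ∀ᵐ x ∂(volume.restrict (Ioo 0 L)), derivOn L 4 u x = h x := by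
    rw [ae_restrict_iff' measurableSet_Ioo]
    filter_upwards with x hx
    rw [hdef, indicator_of_mem hx, hdw x hx]
  have hh : LocallyIntegrable h := by
    apply Integrable.locallyIntegrable
    rw [integrable_indicator_iff measurableSet_Ioo]
    exact ((intervalIntegrable_iff_integrableOn_Ioo_of_le hL.le).1 hAC.intervalIntegrable_deriv)
  have h3 : ∀ x ∈ Icc 0 L, derivOn L 3 u x = derivOn L 3 u 0 + ∫ s in (0 : ℝ)..x, h s := by
    intro x hx
    have := (hAC.mono (c := 0) (d := x) (by
      rw [uIcc_of_le hL.le, uIcc_of_le hx.1]; exact Icc_subset_Icc_right hx.2)).integral_deriv_eq_sub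
    rw [primitive_congr_ae (g := h) _ hx] at this
    · linarith
    · rw [ae_restrict_iff' measurableSet_Ioo]
      filter_upwards with y hy
      rw [hdef, indicator_of_mem hy]
  have h2 : EqOn (fun x => - derivOn L 2 u x) (dirichletInv L h) (Icc 0 L) :=
    eq_dirichletInv (d0 := - derivOn L 3 u 0) (d := fun x => - derivOn L 3 u x) hL hh
      (hcont 2 (by norm_num)).neg (fun x hx => (hder 2 (by norm_num) x hx).neg)
      (fun x hx => by rw [h3 x hx]; ring) (by simp [bc.2.2.1]) (by simp [bc.2.2.2])
  have hv := continuous_dirichletInv L hh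
  have h1 : EqOn u (dirichletInv L (dirichletInv L h)) (Icc 0 L) := by
    refine eq_dirichletInv (d0 := derivOn L 1 u 0) (d := derivOn L 1 u) hL hv.locallyIntegrable
      hC.continuousOn (fun x hx => ?_) ?_ bc.1 bc.2.1
    · have := hder 0 (by norm_num) x hx
      simpa [derivOn] using this
    · intro x hx
      have := integral_eq_sub_of_hasDerivAt_of_le hx.1
        ((hcont 1 (by norm_num)).mono (Icc_subset_Icc_right hx.2))
        (fun y hy => hder 1 (by norm_num) y ⟨hy.1, hy.2.trans_le hx.2⟩)
        (((hcont 2 (by norm_num)).mono (Icc_subset_Icc_right hx.2)).intervalIntegrable_of_Icc hx.1)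
      have h4 : ∫ s in (0 : ℝ)..x, derivOn L 2 u s = - ∫ s in (0 : ℝ)..x, dirichletInv L h s := by
        rw [← intervalIntegral.integral_neg]
        apply intervalIntegral.integral_congr
        intro s hs
        rw [uIcc_of_le hx.1] at hs
        have := h2 ⟨hs.1, hs.2.trans hx.2⟩
        simp only at this ⊢
        linarith
      simp only [Nat.reduceAdd] at this
      linarith
  exact ⟨h, hh, h1, fun x hx => by have := h2 hx; simp only at this ⊢; linarith, hae⟩

/-! ### Hyperbolic inequalities and the Green function of `-v'' + m² v` -/

lemma Real.sinh_lt_mul_cosh {x : ℝ} (hx : 0 < x) : Real.sinh x < x * Real.cosh x := by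
  have hd : ∀ y : ℝ, HasDerivAt (fun y => y * Real.cosh y - Real.sinh y) (y * Real.sinh y) y := by
    intro y
    refine (((hasDerivAt_id y).mul (Real.hasDerivAt_cosh y)).sub
      (Real.hasDerivAt_sinh y)).congr_deriv ?_
    simp
  have hm : StrictMonoOn (fun y => y * Real.cosh y - Real.sinh y) (Ici 0) := by
    apply strictMonoOn_of_deriv_pos (convex_Ici 0)
    · exact fun y _ => (hd y).continuousAt.continuousWithinAt
    · intro y hy
      rw [interior_Ici] at hy
      rw [(hd y).deriv]
      exact mul_pos hy (Real.sinh_pos_iff.2 hy)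
  have := hm (mem_Ici.2 le_rfl) (mem_Ici.2 hx.le) hx
  simp at this
  exact this

/-- By half-angle formulas this is `sinh y < y cosh y` at `y = x / 2`, multiplied by `4 sinh y`. It
lies behind both the bound on the moment kernel and the positivity of the constant `κ` there. -/
lemma Real.two_mul_cosh_sub_one_lt {x : ℝ} (hx : 0 < x) :
    2 * (Real.cosh x - 1) < x * Real.sinh x := by
  have h1 : Real.cosh x - 1 = 2 * Real.sinh (x / 2) ^ 2 := by
    have := Real.cosh_two_mul (x / 2)
    have h2 := Real.cosh_sq (x / 2)
    rw [show 2 * (x / 2) = x by ring] at this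
    linarith
  have h2 : Real.sinh x = 2 * Real.sinh (x / 2) * Real.cosh (x / 2) := by
    rw [← Real.sinh_two_mul]; ring_nf
  rw [h1, h2]
  have h3 := Real.sinh_lt_mul_cosh (x := x / 2) (by positivity)
  have h4 : 0 < Real.sinh (x / 2) := Real.sinh_pos_iff.2 (by positivity)
  nlinarith [mul_lt_mul_of_pos_left h3 h4]

lemma Real.two_mul_cosh_sub_one_le {x : ℝ} (hx : 0 ≤ x) :
    2 * (Real.cosh x - 1) ≤ x * Real.sinh x := by
  rcases hx.eq_or_lt with rfl | hx
  · simp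
  · exact (Real.two_mul_cosh_sub_one_lt hx).le

lemma hasDerivAt_sinh_mul (m x : ℝ) :
    HasDerivAt (fun s => Real.sinh (m * s)) (m * Real.cosh (m * x)) x := by
  refine (((hasDerivAt_id x).const_mul m).sinh).congr_deriv ?_
  simp [mul_comm]

lemma hasDerivAt_cosh_mul (m x : ℝ) :
    HasDerivAt (fun s => Real.cosh (m * s)) (m * Real.sinh (m * x)) x := by
  refine (((hasDerivAt_id x).const_mul m).cosh).congr_deriv ?_
  simp [mul_comm]

lemma hasDerivAt_sinh_mul_sub (m L x : ℝ) :
    HasDerivAt (fun s => Real.sinh (m * (L - s))) (-(m * Real.cosh (m * (L - x)))) x := by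
  refine ((((hasDerivAt_id x).const_sub L).const_mul m).sinh).congr_deriv ?_
  simp [mul_comm]

lemma hasDerivAt_cosh_mul_sub (m L x : ℝ) :
    HasDerivAt (fun s => Real.cosh (m * (L - s))) (-(m * Real.sinh (m * (L - x)))) x := by
  refine ((((hasDerivAt_id x).const_sub L).const_mul m).cosh).congr_deriv ?_
  simp [mul_comm]

/-- The Green function representation of the solution of `-v'' + m² v = f`, `v 0 = v L = 0`. -/
lemma dirichletInv_representation {L m : ℝ} (hL : 0 < L) {h : ℝ → ℝ}
    (hh : LocallyIntegrable h) (x : ℝ) :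
    m * Real.sinh (m * L) * dirichletInv L h x =
      Real.sinh (m * (L - x)) *
        (∫ s in (0 : ℝ)..x, Real.sinh (m * s) * (h s + m ^ 2 * dirichletInv L h s)) +
      Real.sinh (m * x) *
        ∫ s in x..L, Real.sinh (m * (L - s)) * (h s + m ^ 2 * dirichletInv L h s) := by
  -- Both test functions satisfy `θ'' = m² θ`; one vanishes at `0`, the other at `L`, so only
  -- boundary terms at `x` survive. Weighted by `sinh (m (L - x))` and `sinh (m x)`, the terms with
  -- the derivative at `x` cancel.
  have e1 := green_formula L (θ := fun s => Real.sinh (m * s)) hh (hasDerivAt_sinh_mul m)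
    (fun x => (hasDerivAt_cosh_mul m x).const_mul m) (by fun_prop) 0 x
  have e2 := green_formula L (θ := fun s => Real.sinh (m * (L - s))) hh
    (hasDerivAt_sinh_mul_sub m L)
    (fun x => ((hasDerivAt_cosh_mul_sub m L x).const_mul m).neg) (by fun_prop) x L
  have r1 : ∀ s, Real.sinh (m * s) * (h s + m ^ 2 * dirichletInv L h s) =
      Real.sinh (m * s) * h s + m * (m * Real.sinh (m * s)) * dirichletInv L h s :=
    fun s => by ring
  have r2 : ∀ s, Real.sinh (m * (L - s)) * (h s + m ^ 2 * dirichletInv L h s) =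
      Real.sinh (m * (L - s)) * h s +
        -(m * -(m * Real.sinh (m * (L - s)))) * dirichletInv L h s :=
    fun s => by ring
  simp only [r1, r2]
  rw [e1, e2]
  simp only [dirichletInv_zero_left, dirichletInv_zero_right hL, sub_self, mul_zero, Real.sinh_zero]
  have : Real.sinh (m * L) = Real.sinh (m * (L - x)) * Real.cosh (m * x) +
      Real.cosh (m * (L - x)) * Real.sinh (m * x) := by
    rw [← Real.sinh_add]; ring_nf
  rw [this]; ring

lemma integral_nonneg_of_ae_Ioo {L : ℝ} {f : ℝ → ℝ}
    (hf : ∀ᵐ x ∂(volume.restrict (Ioo 0 L)), 0 ≤ f x) {a b : ℝ} (ha : 0 ≤ a) (hab : a ≤ b)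
    (hb : b ≤ L) : 0 ≤ ∫ s in a..b, f s := by
  apply intervalIntegral.integral_nonneg_of_ae_restrict hab
  rw [ae_restrict_iff' measurableSet_Ioo] at hf
  have h2 : ∀ᵐ x : ℝ, x ≠ L := by simp [ae_iff, measure_singleton]
  have h3 : ∀ᵐ x : ℝ, x ≠ 0 := by simp [ae_iff, measure_singleton]
  rw [Filter.EventuallyLE, ae_restrict_iff' measurableSet_Icc]
  filter_upwards [hf, h2, h3] with s hs hs2 hs3 hs4
  exact hs ⟨lt_of_le_of_ne (ha.trans hs4.1) hs3.symm, lt_of_le_of_ne (hs4.2.trans hb) hs2⟩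

/-- The maximum principle for `-v'' + m² v = f`, `v 0 = v L = 0`. -/
lemma dirichletInv_nonneg_of_ae {L m : ℝ} (hL : 0 < L) (hm : 0 < m) {h : ℝ → ℝ}
    (hh : LocallyIntegrable h)
    (hf : ∀ᵐ x ∂(volume.restrict (Ioo 0 L)), 0 ≤ h x + m ^ 2 * dirichletInv L h x)
    {x : ℝ} (hx : x ∈ Icc 0 L) : 0 ≤ dirichletInv L h x := by
  have hrep := dirichletInv_representation (m := m) hL hh x
  have p0 : 0 < Real.sinh (m * L) := Real.sinh_pos_iff.2 (by positivity)
  have p1 : ∀ s, 0 ≤ s → 0 ≤ Real.sinh (m * s) := fun s hs => Real.sinh_nonneg_iff.2 (by positivity)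
  have i1 : 0 ≤ ∫ s in (0 : ℝ)..x, Real.sinh (m * s) * (h s + m ^ 2 * dirichletInv L h s) := by
    refine integral_nonneg_of_ae_Ioo ?_ le_rfl hx.1 hx.2
    filter_upwards [hf, ae_restrict_mem measurableSet_Ioo] with s hs hs2
    exact mul_nonneg (p1 s hs2.1.le) hs
  have i2 : 0 ≤ ∫ s in x..L, Real.sinh (m * (L - s)) * (h s + m ^ 2 * dirichletInv L h s) := by
    refine integral_nonneg_of_ae_Ioo ?_ hx.1 hx.2 le_rfl
    filter_upwards [hf, ae_restrict_mem measurableSet_Ioo] with s hs hs2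
    exact mul_nonneg (p1 _ (sub_nonneg.2 hs2.2.le)) hs
  have : 0 ≤ m * Real.sinh (m * L) * dirichletInv L h x := by
    rw [hrep]
    exact add_nonneg (mul_nonneg (p1 _ (sub_nonneg.2 hx.2)) i1) (mul_nonneg (p1 _ hx.1) i2)
  exact nonneg_of_mul_nonneg_right this (by positivity)

/-- `∫ u = ∫ s (L - s) / 2 * v s` for `u = dirichletInv L v`. -/
lemma integral_dirichletInv {L : ℝ} (hL : 0 < L) {v : ℝ → ℝ} (hv : Continuous v) :
    ∫ s in (0 : ℝ)..L, dirichletInv L v s = ∫ s in (0 : ℝ)..L, s * (L - s) / 2 * v s := by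
  have e := green_formula L (θ := fun s => s * (L - s) / 2) (θ' := fun s => L / 2 - s)
    (θ'' := fun _ => -1) hv.locallyIntegrable
    (fun x => by
      refine (((hasDerivAt_id x).mul ((hasDerivAt_id x).const_sub L)).div_const 2).congr_deriv ?_
      simp; ring)
    (fun x => by
      simpa using (hasDerivAt_id x).const_sub (L / 2)) continuous_const 0 L
  have hc := continuous_dirichletInv L hv.locallyIntegrable
  rw [intervalIntegral.integral_add (Continuous.intervalIntegrable (by fun_prop) _ _)
    (Continuous.intervalIntegrable (by fun_prop) _ _)] at e
  simp only [dirichletInv_zero_left, dirichletInv_zero_right hL, neg_one_mul,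
    intervalIntegral.integral_neg] at e
  linarith

/-- Existence for `-v'' + m² v = g`, `v 0 = v L = 0`. -/
lemma exists_dirichlet_solution {L : ℝ} (hL : 0 < L) (m : ℝ) {g : ℝ → ℝ}
    (hg : LocallyIntegrable g) :
    ∃ v : ℝ → ℝ, Continuous v ∧
      EqOn v (dirichletInv L fun s => g s - m ^ 2 * v s) (Icc 0 L) := by
  -- Factor `v'' - m² v = -g` as `(D - m)(D + m) v = -g`. Solving the two first order equations
  -- gives `v' + m v = exp (m x) (C - P)` and then `v = exp (-m x) Q`; the constant `C` is chosen to
  -- make `Q L = 0`.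
  set P : ℝ → ℝ := fun x => ∫ s in (0 : ℝ)..x, Real.exp (-(m * s)) * g s with hP
  have hgi : LocallyIntegrable fun s => Real.exp (-(m * s)) * g s := by
    have := hg.continuous_smul (g := fun s => Real.exp (-(m * s))) (by fun_prop)
    exact this
  have hPc : Continuous P := continuous_primitive_of_locallyIntegrable hgi
  have hEpos : 0 < ∫ s in (0 : ℝ)..L, Real.exp (2 * m * s) :=
    intervalIntegral.intervalIntegral_pos_of_pos
      (Continuous.intervalIntegrable (by fun_prop) _ _) (fun _ => Real.exp_pos _) hL
  set C : ℝ := (∫ s in (0 : ℝ)..L, Real.exp (2 * m * s) * P s) /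
    ∫ s in (0 : ℝ)..L, Real.exp (2 * m * s) with hC
  set Q : ℝ → ℝ := fun x => ∫ s in (0 : ℝ)..x, Real.exp (2 * m * s) * (C - P s) with hQ
  have hQc : Continuous fun s => Real.exp (2 * m * s) * (C - P s) := by fun_prop
  have hQd : ∀ x, HasDerivAt Q (Real.exp (2 * m * x) * (C - P x)) x := fun x =>
    integral_hasDerivAt_right (hQc.intervalIntegrable _ _)
      (hQc.stronglyMeasurableAtFilter _ _) hQc.continuousAt
  have hQL : Q L = 0 := by
    simp only [hQ, mul_sub]
    rw [intervalIntegral.integral_sub (Continuous.intervalIntegrable (by fun_prop) _ _)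
      (Continuous.intervalIntegrable (by fun_prop) _ _), intervalIntegral.integral_mul_const, hC]
    field_simp
    simp
  have hed : ∀ c x : ℝ, HasDerivAt (fun s => Real.exp (c * s)) (c * Real.exp (c * x)) x := by
    intro c x
    refine (((hasDerivAt_id x).const_mul c).exp).congr_deriv ?_
    simp [mul_comm]
  set v : ℝ → ℝ := fun x => Real.exp (-m * x) * Q x with hv
  set d : ℝ → ℝ := fun x => -m * v x + Real.exp (m * x) * (C - P x) with hd
  have hvd : ∀ x, HasDerivAt v (d x) x := by
    intro x
    refine ((hed (-m) x).mul (hQd x)).congr_deriv ?_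
    have : Real.exp (2 * m * x) = Real.exp (m * x) * Real.exp (m * x) := by
      rw [← Real.exp_add]; ring_nf
    have h2 : Real.exp (-m * x) * Real.exp (m * x) = 1 := by
      rw [← Real.exp_add]; simp
    simp only [hd, hv]
    rw [this]
    linear_combination (Real.exp (m * x) * (C - P x)) * h2
  have hvc : Continuous v := continuous_iff_continuousAt.2 fun x => (hvd x).continuousAt
  have hdc : Continuous d := by fun_prop
  refine ⟨v, hvc, ?_⟩
  have hgv : LocallyIntegrable fun s => g s - m ^ 2 * v s :=
    hg.sub (Continuous.locallyIntegrable (by fun_prop))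
  refine eq_dirichletInv (d0 := d 0) (d := d) hL hgv hvc.continuousOn (fun x _ => hvd x) ?_ ?_ ?_
  · intro x hx
    have ac : ∀ {f f' : ℝ → ℝ}, (∀ x, HasDerivAt f (f' x) x) → Continuous f' →
        AbsolutelyContinuousOnInterval f 0 x := by
      intro f f' hf hf'
      refine (contDiff_one_iff_deriv.2
        ⟨fun x => (hf x).differentiableAt, ?_⟩).contDiffOn.absolutelyContinuousOnInterval
      rwa [show deriv f = f' from funext fun x => (hf x).deriv]
    have acP : AbsolutelyContinuousOnInterval P 0 x :=
      hgi.intervalIntegrable.absolutelyContinuousOnInterval_intervalIntegral left_mem_uIcc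
    have acd : AbsolutelyContinuousOnInterval d 0 x :=
      ((ac hvd hdc).const_mul (-m)).fun_add
        ((ac (hed m) (by fun_prop)).fun_mul
          ((ac (fun x => hasDerivAt_const x C) continuous_const).fun_sub acP))
    have hi : ∫ s in (0 : ℝ)..x, deriv d s = - ∫ s in (0 : ℝ)..x, (g s - m ^ 2 * v s) := by
      rw [← intervalIntegral.integral_neg]
      apply intervalIntegral.integral_congr_ae
      filter_upwards [LocallyIntegrable.ae_hasDerivAt_integral hgi] with s hs _
      have hPd : HasDerivAt P (Real.exp (-(m * s)) * g s) s := hs 0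
      have := ((hvd s).const_mul (-m)).add ((hed m s).mul (hPd.const_sub C))
      have h2 : Real.exp (m * s) * Real.exp (-(m * s)) = 1 := by
        rw [← Real.exp_add]; simp
      refine HasDerivAt.deriv (this.congr_deriv ?_)
      simp only [hd]
      linear_combination - g s * h2
    rw [acd.integral_deriv_eq_sub] at hi
    linarith
  · simp [hv, hQ]
  · simp [hv, hQL]

/-! ### The kernel recovering `∫ u` from the right-hand side -/

/-- The solution `ψ` of `-ψ'' + m² ψ = s (L - s) / 2`, `ψ 0 = ψ L = 0`. -/
noncomputable def momentKernel (L m s : ℝ) : ℝ :=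
  (s * (L - s) / 2 - (1 - Real.cosh (m * s) +
    (Real.cosh (m * L) - 1) / Real.sinh (m * L) * Real.sinh (m * s)) / m ^ 2) / m ^ 2

/-- The reflection carries the bound `momentKernel_le`, adapted to the end point `0`, over to the
end point `L`. -/
lemma momentKernel_symm {L m : ℝ} (hz : 0 < Real.sinh (m * L)) (s : ℝ) :
    momentKernel L m (L - s) = momentKernel L m s := by
  have h1 := Real.cosh_sub (m * L) (m * s)
  have h2 := Real.sinh_sub (m * L) (m * s)
  have h3 := Real.cosh_sq (m * L)
  have key : 1 - Real.cosh (m * (L - s)) +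
      (Real.cosh (m * L) - 1) / Real.sinh (m * L) * Real.sinh (m * (L - s)) =
      1 - Real.cosh (m * s) +
      (Real.cosh (m * L) - 1) / Real.sinh (m * L) * Real.sinh (m * s) := by
    rw [mul_sub, h1, h2]
    field_simp
    linear_combination (- Real.sinh (m * s)) * h3
  rw [momentKernel, momentKernel, key]
  ring

lemma momentKernel_zero_left (L m : ℝ) : momentKernel L m 0 = 0 := by
  simp [momentKernel]

lemma momentKernel_zero_right {L m : ℝ} (hz : 0 < Real.sinh (m * L)) :
    momentKernel L m L = 0 := by
  rw [← momentKernel_symm hz, sub_self, momentKernel_zero_left]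

/-- The coefficient is `ψ'(0) / m`, so the two sides are tangent at `0`. Their gap is a positive
multiple of `m L (sinh (m s) - m s) - (2 (cosh (m s) - 1) - (m s)²)`; replacing `L` by the smaller
`s` leaves `2 (cosh (m s) - 1) ≤ m s sinh (m s)`. -/
lemma momentKernel_le {L m s : ℝ} (hm : 0 < m) (h0 : 0 ≤ s) (hs : s ≤ L) :
    momentKernel L m s ≤
      (L / 2 - (Real.cosh (m * L) - 1) / Real.sinh (m * L) / m) / m ^ 3 * Real.sinh (m * s) := by
  have h1 : m * s ≤ Real.sinh (m * s) := Real.self_le_sinh_iff.2 (by positivity)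
  have h2 := Real.two_mul_cosh_sub_one_le (x := m * s) (by positivity)
  have h3 : s * (Real.sinh (m * s) - m * s) ≤ L * (Real.sinh (m * s) - m * s) :=
    mul_le_mul_of_nonneg_right hs (by linarith)
  rw [← sub_nonneg]
  have : (L / 2 - (Real.cosh (m * L) - 1) / Real.sinh (m * L) / m) / m ^ 3 * Real.sinh (m * s) -
      momentKernel L m s = (m * (L * (Real.sinh (m * s) - m * s)) -
        (2 * (Real.cosh (m * s) - 1) - (m * s) ^ 2)) / (2 * m ^ 4) := by
    rw [momentKernel]
    generalize (Real.cosh (m * L) - 1) / Real.sinh (m * L) = t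
    field_simp
    ring
  rw [this]
  apply div_nonneg _ (by positivity)
  nlinarith [mul_le_mul_of_nonneg_left h3 hm.le]

/-- The second derivative of `momentKernel L m`. -/
noncomputable def momentKernelDerivTwo (L m s : ℝ) : ℝ :=
  (-1 - (-Real.cosh (m * s) +
    (Real.cosh (m * L) - 1) / Real.sinh (m * L) * Real.sinh (m * s))) / m ^ 2

lemma continuous_momentKernel (L m : ℝ) : Continuous (momentKernel L m) := by
  unfold momentKernel; fun_prop

lemma continuous_momentKernelDerivTwo (L m : ℝ) : Continuous (momentKernelDerivTwo L m) := by
  unfold momentKernelDerivTwo; fun_prop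

lemma momentKernel_eq {L m : ℝ} (hm : m ≠ 0) (s : ℝ) :
    m ^ 2 * momentKernel L m s = s * (L - s) / 2 + momentKernelDerivTwo L m s := by
  rw [momentKernel, momentKernelDerivTwo]
  field_simp
  ring

lemma integral_momentKernel {L m : ℝ} (hm : m ≠ 0) (hz : 0 < Real.sinh (m * L)) :
    ∫ s in (0 : ℝ)..L, momentKernel L m s =
      (L ^ 3 / 12 - (L - 2 * ((Real.cosh (m * L) - 1) / Real.sinh (m * L)) / m) / m ^ 2) / m ^ 2 := by
  set t := (Real.cosh (m * L) - 1) / Real.sinh (m * L) with ht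
  have hd : ∀ s, HasDerivAt (fun s => (s ^ 2 * L / 4 - s ^ 3 / 6 -
      (s - Real.sinh (m * s) / m + t * (Real.cosh (m * s) / m)) / m ^ 2) / m ^ 2)
      (momentKernel L m s) s := by
    intro s
    have h1 := (((hasDerivAt_id s).pow 2).mul_const L).div_const 4
    have h2 := ((hasDerivAt_id s).pow 3).div_const 6
    have h3 := (((hasDerivAt_id s).sub ((hasDerivAt_sinh_mul m s).div_const m)).add
      (((hasDerivAt_cosh_mul m s).div_const m).const_mul t)).div_const (m ^ 2)
    refine (((h1.sub h2).sub h3).div_const (m ^ 2)).congr_deriv ?_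
    rw [momentKernel, ← ht]
    simp
    field_simp
    ring
  rw [integral_eq_sub_of_hasDerivAt (fun s _ => hd s)
    ((continuous_momentKernel L m).intervalIntegrable _ _)]
  have h3 := Real.cosh_sq (m * L)
  -- This is `t (cosh (m L) + 1) = sinh (m L)`, the only hyperbolic relation needed; the rest is
  -- rational algebra.
  have h4 : t * (Real.cosh (m * L) - 1) = Real.sinh (m * L) - 2 * t := by
    rw [ht]; field_simp; linear_combination h3
  simp only [mul_zero, Real.sinh_zero, Real.cosh_zero]
  clear_value t
  generalize Real.cosh (m * L) = c at h4 ⊢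
  generalize Real.sinh (m * L) = S at h4 ⊢
  field_simp
  linear_combination (-288) * h4

/-- Moving `-d²/dx² + m²` from `v = R h` onto the kernel `ψ` produces `∫ s (L - s) / 2 * v`, which
is `∫ R v`. The constant nonlocal term contributes the factor `N ∫ ψ`. Thus the unknown `∫ u` is
expressed through the full right-hand side alone. -/
lemma integral_momentKernel_mul {L m N : ℝ} (hL : 0 < L) (hm : 0 < m) {h : ℝ → ℝ}
    (hh : LocallyIntegrable h) :
    ∫ s in (0 : ℝ)..L, momentKernel L m s * (h s + m ^ 2 * dirichletInv L h s +
        N * ∫ t in (0 : ℝ)..L, dirichletInv L (dirichletInv L h) t) =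
      (1 + N * ∫ s in (0 : ℝ)..L, momentKernel L m s) *
        ∫ t in (0 : ℝ)..L, dirichletInv L (dirichletInv L h) t := by
  have hz : 0 < Real.sinh (m * L) := Real.sinh_pos_iff.2 (by positivity)
  have hv := continuous_dirichletInv L hh
  set t := (Real.cosh (m * L) - 1) / Real.sinh (m * L) with ht
  have hk1 : ∀ s, HasDerivAt (momentKernel L m)
      ((L / 2 - s - (-(m * Real.sinh (m * s)) + t * (m * Real.cosh (m * s))) / m ^ 2) / m ^ 2) s := by
    intro s
    have h1 := (((hasDerivAt_id s).mul ((hasDerivAt_id s).const_sub L)).div_const 2)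
    have h2 := (((hasDerivAt_cosh_mul m s).const_sub 1).add
      ((hasDerivAt_sinh_mul m s).const_mul t)).div_const (m ^ 2)
    refine ((h1.sub h2).div_const (m ^ 2)).congr_deriv ?_
    simp; ring
  have hk2 : ∀ s, HasDerivAt (fun s =>
      (L / 2 - s - (-(m * Real.sinh (m * s)) + t * (m * Real.cosh (m * s))) / m ^ 2) / m ^ 2)
      (momentKernelDerivTwo L m s) s := by
    intro s
    have h2 := ((((hasDerivAt_sinh_mul m s).const_mul m).neg).add
      (((hasDerivAt_cosh_mul m s).const_mul m).const_mul t)).div_const (m ^ 2)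
    refine ((((hasDerivAt_id s).const_sub (L / 2)).sub h2).div_const (m ^ 2)).congr_deriv ?_
    rw [momentKernelDerivTwo, ← ht]
    field_simp
  have hg := green_formula L hh hk1 hk2 (continuous_momentKernelDerivTwo L m) 0 L
  simp only [dirichletInv_zero_left, dirichletInv_zero_right hL, momentKernel_zero_left,
    momentKernel_zero_right hz, mul_zero, zero_mul, sub_self] at hg
  set J := ∫ t in (0 : ℝ)..L, dirichletInv L (dirichletInv L h) t with hJ
  have hψ := continuous_momentKernel L m
  have hψ2 := continuous_momentKernelDerivTwo L m
  have i1 : IntervalIntegrable (fun s => momentKernel L m s * h s +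
      momentKernelDerivTwo L m s * dirichletInv L h s) volume 0 L :=
    (hh.intervalIntegrable.continuousOn_mul hψ.continuousOn).add
      (Continuous.intervalIntegrable (by fun_prop) _ _)
  have i2 : IntervalIntegrable (fun s => s * (L - s) / 2 * dirichletInv L h s) volume 0 L :=
    Continuous.intervalIntegrable (by fun_prop) _ _
  have i3 : IntervalIntegrable (fun s => momentKernel L m s * (N * J)) volume 0 L :=
    Continuous.intervalIntegrable (by fun_prop) _ _
  have e : ∀ s, momentKernel L m s * (h s + m ^ 2 * dirichletInv L h s + N * J) =
      (momentKernel L m s * h s + momentKernelDerivTwo L m s * dirichletInv L h s) +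
      s * (L - s) / 2 * dirichletInv L h s + momentKernel L m s * (N * J) := by
    intro s
    linear_combination dirichletInv L h s * momentKernel_eq (L := L) hm.ne' s
  simp only [e]
  rw [intervalIntegral.integral_add (i1.add i2) i3, intervalIntegral.integral_add i1 i2, hg,
    ← integral_dirichletInv hL hv, intervalIntegral.integral_mul_const, ← hJ]
  ring

/-! ### Maximum principle, comparison and solvability for the nonlocal operator -/

lemma integral_mono_of_ae_Ioo {L : ℝ} {f g : ℝ → ℝ}
    (hfg : ∀ᵐ x ∂(volume.restrict (Ioo 0 L)), f x ≤ g x) {a b : ℝ} (ha : 0 ≤ a) (hab : a ≤ b)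
    (hb : b ≤ L) (hf : IntervalIntegrable f volume a b) (hg : IntervalIntegrable g volume a b) :
    ∫ s in a..b, f s ≤ ∫ s in a..b, g s := by
  rw [← sub_nonneg, ← intervalIntegral.integral_sub hg hf]
  exact integral_nonneg_of_ae_Ioo (hfg.mono fun x hx => sub_nonneg.2 hx) ha hab hb

/-- The maximum principle for `u'''' - m² u'' + N ∫ u = f` with Navier boundary conditions,
in terms of `v = -u'' = dirichletInv L h`. -/
lemma dirichletInv_nonneg_of_nonlocal {L m N : ℝ} (hL : 0 < L) (hm : 0 < m) (hN : 0 < N)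
    (hcond : N * (6 * (m * L) * Real.cosh (m * L) + 6 * (m * L) - 12 * Real.sinh (m * L)
      - (m * L) ^ 3) ≤ 12 * m ^ 5) {h : ℝ → ℝ} (hh : LocallyIntegrable h)
    (hf : ∀ᵐ x ∂(volume.restrict (Ioo 0 L)), 0 ≤ h x + m ^ 2 * dirichletInv L h x +
        N * ∫ t in (0 : ℝ)..L, dirichletInv L (dirichletInv L h) t)
    {x : ℝ} (hx : x ∈ Icc 0 L) : 0 ≤ dirichletInv L h x := by
  have hz : 0 < Real.sinh (m * L) := Real.sinh_pos_iff.2 (by positivity)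
  have hv := continuous_dirichletInv L hh
  have hmom := integral_momentKernel_mul (N := N) hL hm hh
  have hK := integral_momentKernel hm.ne' hz
  have hrep := dirichletInv_representation (m := m) hL hh x
  set J := ∫ t in (0 : ℝ)..L, dirichletInv L (dirichletInv L h) t with hJ
  set K := ∫ s in (0 : ℝ)..L, momentKernel L m s
  set t := (Real.cosh (m * L) - 1) / Real.sinh (m * L) with ht
  set κ := (L / 2 - t / m) / m ^ 3 with hκ
  set f : ℝ → ℝ := fun s => h s + m ^ 2 * dirichletInv L h s + N * J with hfdef
  have hfl : LocallyIntegrable f :=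
    (hh.add (Continuous.locallyIntegrable (by fun_prop))).add (locallyIntegrable_const _)
  have hfi : ∀ {θ : ℝ → ℝ} {a b : ℝ}, Continuous θ →
      IntervalIntegrable (fun s => θ s * f s) volume a b := fun hθ =>
    hfl.intervalIntegrable.continuousOn_mul hθ.continuousOn
  have p1 : ∀ s, 0 ≤ s → 0 ≤ Real.sinh (m * s) := fun s hs => Real.sinh_nonneg_iff.2 (by positivity)
  have hw := p1 (L - x) (sub_nonneg.2 hx.2)
  have hy := p1 x hx.1
  have hc1 : 1 < Real.cosh (m * L) := Real.one_lt_cosh.2 (by positivity)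
  have hκ0 : 0 < κ := by
    have h2 := Real.two_mul_cosh_sub_one_lt (x := m * L) (by positivity)
    have : t / m < L / 2 := by
      rw [ht, div_div, div_lt_div_iff₀ (by positivity) (by positivity)]
      linarith
    exact div_pos (by linarith) (by positivity)
  set A := ∫ s in (0 : ℝ)..x, Real.sinh (m * s) * f s with hA
  set B := ∫ s in x..L, Real.sinh (m * (L - s)) * f s with hB
  have hA0 : 0 ≤ A := by
    refine integral_nonneg_of_ae_Ioo ?_ le_rfl hx.1 hx.2
    filter_upwards [hf, ae_restrict_mem measurableSet_Ioo] with s hs hs2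
    exact mul_nonneg (p1 s hs2.1.le) hs
  have hB0 : 0 ≤ B := by
    refine integral_nonneg_of_ae_Ioo ?_ hx.1 hx.2 le_rfl
    filter_upwards [hf, ae_restrict_mem measurableSet_Ioo] with s hs hs2
    exact mul_nonneg (p1 _ (sub_nonneg.2 hs2.2.le)) hs
  have hψA : ∫ s in (0 : ℝ)..x, momentKernel L m s * f s ≤ κ * A := by
    rw [hA, ← intervalIntegral.integral_const_mul]
    refine integral_mono_of_ae_Ioo (L := L) ?_ le_rfl hx.1 hx.2 (hfi (continuous_momentKernel L m))
      ((hfi (by fun_prop)).const_mul κ)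
    filter_upwards [hf, ae_restrict_mem measurableSet_Ioo] with s hs hs2
    rw [← mul_assoc]
    exact mul_le_mul_of_nonneg_right (momentKernel_le hm hs2.1.le hs2.2.le) hs
  have hψB : ∫ s in x..L, momentKernel L m s * f s ≤ κ * B := by
    rw [hB, ← intervalIntegral.integral_const_mul]
    refine integral_mono_of_ae_Ioo (L := L) ?_ hx.1 hx.2 le_rfl (hfi (continuous_momentKernel L m))
      ((hfi (by fun_prop)).const_mul κ)
    filter_upwards [hf, ae_restrict_mem measurableSet_Ioo] with s hs hs2
    rw [← mul_assoc, ← momentKernel_symm hz]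
    exact mul_le_mul_of_nonneg_right
      (momentKernel_le hm (sub_nonneg.2 hs2.2.le) (by linarith [hs2.1])) hs
  -- Split at `x`, using the bound from `0` on the left and its reflection on the right: these are
  -- exactly the weights in the Green representation at `x`.
  have hψ : (1 + N * K) * J ≤ κ * A + κ * B := by
    rw [← hmom]
    change ∫ s in (0 : ℝ)..L, momentKernel L m s * f s ≤ _
    rw [← intervalIntegral.integral_add_adjacent_intervals
      (hfi (b := x) (continuous_momentKernel L m)) (hfi (continuous_momentKernel L m))]
    exact add_le_add hψA hψB
  -- the representation of `v` in terms of `f`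
  have s1 : ∫ s in (0 : ℝ)..x, Real.sinh (m * s) = (Real.cosh (m * x) - 1) / m := by
    rw [integral_eq_sub_of_hasDerivAt (f := fun s => Real.cosh (m * s) / m)
      (fun s _ => ((hasDerivAt_cosh_mul m s).div_const m).congr_deriv (by field_simp))
      (Continuous.intervalIntegrable (by fun_prop) _ _)]
    simp; ring
  have s2 : ∫ s in x..L, Real.sinh (m * (L - s)) = (Real.cosh (m * (L - x)) - 1) / m := by
    rw [integral_eq_sub_of_hasDerivAt (f := fun s => - (Real.cosh (m * (L - s)) / m))
      (fun s _ => ((hasDerivAt_cosh_mul_sub m L s).div_const m).neg.congr_deriv (by field_simp))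
      (Continuous.intervalIntegrable (by fun_prop) _ _)]
    simp; ring
  have r1 : ∫ s in (0 : ℝ)..x, Real.sinh (m * s) * (h s + m ^ 2 * dirichletInv L h s) =
      A - (Real.cosh (m * x) - 1) / m * (N * J) := by
    rw [hA, ← s1, ← intervalIntegral.integral_mul_const, ← intervalIntegral.integral_sub
      (hfi (by fun_prop)) (Continuous.intervalIntegrable (by fun_prop) _ _)]
    congr 1; ext s; simp only [hfdef]; ring
  have r2 : ∫ s in x..L, Real.sinh (m * (L - s)) * (h s + m ^ 2 * dirichletInv L h s) =
      B - (Real.cosh (m * (L - x)) - 1) / m * (N * J) := by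
    rw [hB, ← s2, ← intervalIntegral.integral_mul_const, ← intervalIntegral.integral_sub
      (hfi (by fun_prop)) (Continuous.intervalIntegrable (by fun_prop) _ _)]
    congr 1; ext s; simp only [hfdef]; ring
  rw [r1, r2] at hrep
  have hsum : m * x + m * (L - x) = m * L := by ring
  have hS := Real.sinh_add (m * x) (m * (L - x))
  have hCo := Real.cosh_add (m * x) (m * (L - x))
  rw [hsum] at hS hCo
  have hcy : 1 ≤ Real.cosh (m * x) := Real.one_le_cosh _
  have hcw : 1 ≤ Real.cosh (m * (L - x)) := Real.one_le_cosh _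
  -- `E / m` is the Green representation of a unit constant load, so the nonlocal term enters it as
  -- `-(N J / m) E`.
  set E := Real.sinh (m * (L - x)) * (Real.cosh (m * x) - 1) +
    Real.sinh (m * x) * (Real.cosh (m * (L - x)) - 1) with hE
  have hE0 : 0 ≤ E := by
    have := mul_nonneg hw (sub_nonneg.2 hcy)
    have := mul_nonneg hy (sub_nonneg.2 hcw)
    linarith
  have hEw : E ≤ (Real.cosh (m * L) - 1) * Real.sinh (m * (L - x)) := by
    have h1 := mul_nonneg hz.le (sub_nonneg.2 hcw)
    have h2 := Real.cosh_sq (m * (L - x))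
    have : (Real.cosh (m * L) - 1) * Real.sinh (m * (L - x)) - E =
        Real.sinh (m * L) * (Real.cosh (m * (L - x)) - 1) := by
      rw [hE, hS, hCo]
      linear_combination (- Real.sinh (m * x)) * h2
    linarith
  have hEy : E ≤ (Real.cosh (m * L) - 1) * Real.sinh (m * x) := by
    have h1 := mul_nonneg hz.le (sub_nonneg.2 hcy)
    have h2 := Real.cosh_sq (m * x)
    have : (Real.cosh (m * L) - 1) * Real.sinh (m * x) - E =
        Real.sinh (m * L) * (Real.cosh (m * x) - 1) := by
      rw [hE, hS, hCo]
      linear_combination (- Real.sinh (m * (L - x))) * h2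
    linarith
  set W := Real.sinh (m * (L - x)) * A + Real.sinh (m * x) * B with hW
  have hW0 : 0 ≤ W := add_nonneg (mul_nonneg hw hA0) (mul_nonneg hy hB0)
  -- Use the bound `hEw` on `E` against `A` and `hEy` against `B`: the nonlocal term is then
  -- dominated by a multiple of the same `W` that carries the contribution of `f`.
  have hEJ : E * ((1 + N * K) * J) ≤ κ * (Real.cosh (m * L) - 1) * W := by
    have h1 := mul_le_mul_of_nonneg_left hψ hE0
    have h2 := mul_le_mul_of_nonneg_right hEw (mul_nonneg hκ0.le hA0)
    have h3 := mul_le_mul_of_nonneg_right hEy (mul_nonneg hκ0.le hB0)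
    rw [hW]; linarith
  -- With the closed form of `K` inserted, this is precisely `hcond`.
  have hC : N * (κ * (Real.cosh (m * L) - 1) / m) ≤ 1 + N * K := by
    have : κ * (Real.cosh (m * L) - 1) / m - K =
        (6 * (m * L) * Real.cosh (m * L) + 6 * (m * L) - 12 * Real.sinh (m * L)
          - (m * L) ^ 3) / (12 * m ^ 5) := by
      have h4 : t * (Real.cosh (m * L) - 1) = Real.sinh (m * L) - 2 * t := by
        rw [ht]; field_simp; linear_combination Real.cosh_sq (m * L)
      rw [hκ, hK]
      clear_value t
      generalize Real.cosh (m * L) = c at h4 ⊢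
      generalize Real.sinh (m * L) = S at h4 ⊢
      field_simp
      linear_combination (-24) * h4
    have h5 : N * (κ * (Real.cosh (m * L) - 1) / m - K) ≤ 1 := by
      rw [this, ← mul_div_assoc, div_le_one (by positivity)]
      exact hcond
    linarith
  have hκpos : 0 < N * (κ * (Real.cosh (m * L) - 1) / m) :=
    mul_pos hN (div_pos (mul_pos hκ0 (by linarith)) hm)
  have hfin : 0 ≤ (1 + N * K) * (m * Real.sinh (m * L) * dirichletInv L h x) := by
    rw [hrep]
    have h1 := mul_le_mul_of_nonneg_right hC hW0
    have h2 := mul_le_mul_of_nonneg_left hEJ (div_nonneg hN.le hm.le)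
    have h3 : (1 + N * K) * (Real.sinh (m * (L - x)) * (A - (Real.cosh (m * x) - 1) / m * (N * J)) +
        Real.sinh (m * x) * (B - (Real.cosh (m * (L - x)) - 1) / m * (N * J))) =
        (1 + N * K) * W - N / m * (E * ((1 + N * K) * J)) := by
      rw [hW, hE]; ring
    have h4 : N / m * (κ * (Real.cosh (m * L) - 1) * W) =
        N * (κ * (Real.cosh (m * L) - 1) / m) * W := by ring
    linarith
  have h5 := nonneg_of_mul_nonneg_right hfin (hκpos.trans_le hC)
  exact nonneg_of_mul_nonneg_right h5 (by positivity)

lemma integral_congr_Icc {L : ℝ} (hL : 0 < L) {f g : ℝ → ℝ} (h : EqOn f g (Icc 0 L)) :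
    ∫ t in (0 : ℝ)..L, f t = ∫ t in (0 : ℝ)..L, g t :=
  intervalIntegral.integral_congr (by rwa [uIcc_of_le hL.le])

/-- Comparison for `u'''' - m² u'' + N ∫ u` with Navier boundary conditions. -/
lemma navier_comparison {L m N : ℝ} (hL : 0 < L) (hm : 0 < m) (hN : 0 < N)
    (hcond : N * (6 * (m * L) * Real.cosh (m * L) + 6 * (m * L) - 12 * Real.sinh (m * L)
      - (m * L) ^ 3) ≤ 12 * m ^ 5) {u₁ u₂ : ℝ → ℝ} (hu₁ : IsW41 L u₁) (bc₁ : NavierBC L u₁)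
    (hu₂ : IsW41 L u₂) (bc₂ : NavierBC L u₂)
    (hle : ∀ᵐ x ∂(volume.restrict (Ioo 0 L)),
      derivOn L 4 u₁ x - m ^ 2 * derivOn L 2 u₁ x + N * (∫ t in (0 : ℝ)..L, u₁ t) ≤
      derivOn L 4 u₂ x - m ^ 2 * derivOn L 2 u₂ x + N * ∫ t in (0 : ℝ)..L, u₂ t) :
    ∀ x ∈ Icc 0 L, u₁ x ≤ u₂ x ∧ derivOn L 2 u₂ x ≤ derivOn L 2 u₁ x := by
  obtain ⟨h₁, i₁, e₁, d₁, f₁⟩ := exists_dirichletInv_of_isW41 hL hu₁ bc₁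
  obtain ⟨h₂, i₂, e₂, d₂, f₂⟩ := exists_dirichletInv_of_isW41 hL hu₂ bc₂
  have hh : LocallyIntegrable fun s => h₂ s - h₁ s := i₂.sub i₁
  have c₁ := continuous_dirichletInv L i₁
  have c₂ := continuous_dirichletInv L i₂
  have hv : dirichletInv L (fun s => h₂ s - h₁ s) =
      fun x => dirichletInv L h₂ x - dirichletInv L h₁ x :=
    funext fun x => dirichletInv_sub L i₂ i₁ x
  have hu : dirichletInv L (dirichletInv L fun s => h₂ s - h₁ s) =
      fun x => dirichletInv L (dirichletInv L h₂) x - dirichletInv L (dirichletInv L h₁) x := by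
    rw [hv]
    exact funext fun x => dirichletInv_sub L c₂.locallyIntegrable c₁.locallyIntegrable x
  have hpos : ∀ x ∈ Icc 0 L, 0 ≤ dirichletInv L (fun s => h₂ s - h₁ s) x := by
    intro x hx
    refine dirichletInv_nonneg_of_nonlocal hL hm hN hcond hh ?_ hx
    filter_upwards [hle, f₁, f₂, ae_restrict_mem measurableSet_Ioo] with y hy g₁ g₂ hyI
    rw [hu, intervalIntegral.integral_sub
      ((continuous_dirichletInv L c₂.locallyIntegrable).intervalIntegrable _ _)
      ((continuous_dirichletInv L c₁.locallyIntegrable).intervalIntegrable _ _),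
      ← integral_congr_Icc hL e₁, ← integral_congr_Icc hL e₂, hv]
    rw [g₁, g₂, d₁ (Ioo_subset_Icc_self hyI), d₂ (Ioo_subset_Icc_self hyI)] at hy
    simp only at hy ⊢
    linarith
  intro x hx
  have h1 := hpos x hx
  have h2 := dirichletInv_nonneg (hv ▸ (c₂.sub c₁).locallyIntegrable) hpos hx
  rw [hu] at h2
  rw [hv] at h1
  rw [e₁ hx, e₂ hx, d₁ hx, d₂ hx]
  simp only at h1 h2 ⊢
  constructor <;> linarith

/-- Existence for `u'''' - m² u'' + N ∫ u = f` with Navier boundary conditions. -/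
lemma exists_navier_solution {L m N : ℝ} (hL : 0 < L) (hm : 0 < m) (hN : 0 < N) {f : ℝ → ℝ}
    (hf : LocallyIntegrable f) :
    ∃ u, IsW41 L u ∧ NavierBC L u ∧ ∀ᵐ x ∂(volume.restrict (Ioo 0 L)),
      derivOn L 4 u x - m ^ 2 * derivOn L 2 u x + N * (∫ t in (0 : ℝ)..L, u t) = f x := by
  -- By linearity `-u'' = v - N J e`, with `e` the response to the load `1` and `J = ∫ u`.
  -- Integrating gives a scalar linear equation for `J`, with coefficient `1 + N ∫ R e`, positive
  -- because `e ≥ 0`.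
  obtain ⟨v, hvc, hv⟩ := exists_dirichlet_solution hL m hf
  obtain ⟨e, hec, he⟩ := exists_dirichlet_solution hL m (locallyIntegrable_const (1 : ℝ))
  have hgv : LocallyIntegrable fun s => f s - m ^ 2 * v s :=
    hf.sub (Continuous.locallyIntegrable (by fun_prop))
  have hge : Continuous fun s => 1 - m ^ 2 * e s := by fun_prop
  have hepos : ∀ x ∈ Icc 0 L, 0 ≤ e x := by
    intro x hx
    rw [he hx]
    refine dirichletInv_nonneg_of_ae hL hm hge.locallyIntegrable ?_ hx
    filter_upwards [ae_restrict_mem measurableSet_Ioo] with y hy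
    rw [← he (Ioo_subset_Icc_self hy)]
    simp
  have hK : 0 ≤ ∫ t in (0 : ℝ)..L, dirichletInv L e t :=
    intervalIntegral.integral_nonneg hL.le fun x hx =>
      dirichletInv_nonneg hec.locallyIntegrable hepos hx
  set J := (∫ t in (0 : ℝ)..L, dirichletInv L v t) / (1 + N * ∫ t in (0 : ℝ)..L, dirichletInv L e t)
    with hJ
  have hJ' : (∫ t in (0 : ℝ)..L, dirichletInv L v t) -
      N * J * (∫ t in (0 : ℝ)..L, dirichletInv L e t) = J := by
    have : (1 + N * ∫ t in (0 : ℝ)..L, dirichletInv L e t) ≠ 0 := by positivity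
    rw [hJ]; field_simp; ring
  set h : ℝ → ℝ := fun s => (f s - m ^ 2 * v s) - N * J * (1 - m ^ 2 * e s) with hdef
  have hh : LocallyIntegrable h := hgv.sub (Continuous.locallyIntegrable (by fun_prop))
  have hRh : EqOn (dirichletInv L h) (fun s => v s - N * J * e s) (Icc 0 L) := by
    intro x hx
    rw [hdef, dirichletInv_sub L hgv (Continuous.locallyIntegrable (by fun_prop)),
      dirichletInv_const_mul, ← hv hx, ← he hx]
  have hint : ∫ t in (0 : ℝ)..L, dirichletInv L (dirichletInv L h) t = J := by
    rw [← hJ', ← intervalIntegral.integral_const_mul, ← intervalIntegral.integral_sub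
      ((continuous_dirichletInv L hvc.locallyIntegrable).intervalIntegrable _ _)
      (((continuous_dirichletInv L hec.locallyIntegrable).const_mul _).intervalIntegrable _ _)]
    refine integral_congr_Icc hL fun x hx => ?_
    rw [dirichletInv_congr hRh hx, dirichletInv_sub L hvc.locallyIntegrable
      (Continuous.locallyIntegrable (by fun_prop)), dirichletInv_const_mul]
  refine ⟨dirichletInv L (dirichletInv L h), isW41_dirichletInv_dirichletInv hL hh,
    navierBC_dirichletInv_dirichletInv hL hh, ?_⟩
  filter_upwards [derivOn_four_dirichletInv_dirichletInv hL hh,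
    ae_restrict_mem measurableSet_Ioo] with x hx hxI
  rw [hx, hint, derivOn_two_dirichletInv hL (continuous_dirichletInv L hh)
    (Ioo_subset_Icc_self hxI)]
  simp only
  rw [hRh (Ioo_subset_Icc_self hxI)]
  simp only [hdef]
  ring

/-! ### Passage to the limit under the Dirichlet inverse -/

lemma abs_dirichletInv_le {L : ℝ} {g : ℝ → ℝ} (hg : LocallyIntegrable g) {x : ℝ}
    (hx : x ∈ Icc 0 L) :
    |dirichletInv L g x| ≤ 2 * L * ∫ s in (0 : ℝ)..L, |g s| := by
  have hL : 0 ≤ L := hx.1.trans hx.2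
  set Q := ∫ s in (0 : ℝ)..L, |g s| with hQ
  have hQ0 : 0 ≤ Q := intervalIntegral.integral_nonneg hL fun _ _ => abs_nonneg _
  have h1 : ∀ t ∈ Icc 0 L, |∫ s in (0 : ℝ)..t, g s| ≤ Q := by
    intro t ht
    refine (intervalIntegral.abs_integral_le_integral_abs ht.1).trans ?_
    exact intervalIntegral.integral_mono_interval le_rfl ht.1 ht.2
      (Eventually.of_forall fun _ => abs_nonneg _) hg.intervalIntegrable.abs
  have h2 : ∀ y ∈ Icc 0 L, |∫ t in (0 : ℝ)..y, ∫ s in (0 : ℝ)..t, g s| ≤ Q * L := by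
    intro y hy
    have := intervalIntegral.norm_integral_le_of_norm_le_const (a := 0) (b := y) (C := Q)
      (f := fun t => ∫ s in (0 : ℝ)..t, g s) (fun t ht => by
        rw [uIoc_of_le hy.1] at ht
        exact h1 t ⟨ht.1.le, ht.2.trans hy.2⟩)
    rw [Real.norm_eq_abs, sub_zero, abs_of_nonneg hy.1] at this
    exact this.trans (mul_le_mul_of_nonneg_left hy.2 hQ0)
  have h3 : |x / L| ≤ 1 := by
    rw [abs_of_nonneg (div_nonneg hx.1 hL)]
    exact div_le_one_of_le₀ hx.2 hL
  rw [dirichletInv]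
  refine (abs_sub _ _).trans ?_
  rw [abs_mul]
  have h4 := mul_le_mul h3 (h2 L ⟨hL, le_rfl⟩) (abs_nonneg _) zero_le_one
  have h5 := h2 x hx
  linarith

/-- Dominated convergence for `dirichletInv`. -/
lemma tendstoUniformlyOn_dirichletInv {L : ℝ} (hL : 0 < L) {g : ℕ → ℝ → ℝ} {g₀ G : ℝ → ℝ}
    (hg : ∀ k, LocallyIntegrable (g k)) (hg₀ : LocallyIntegrable g₀) (hG : LocallyIntegrable G)
    (hb : ∀ k, ∀ᵐ x ∂(volume.restrict (Ioo 0 L)), |g k x| ≤ G x)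
    (hlim : ∀ᵐ x ∂(volume.restrict (Ioo 0 L)), Tendsto (fun k => g k x) atTop (𝓝 (g₀ x))) :
    TendstoUniformlyOn (fun k => dirichletInv L (g k)) (dirichletInv L g₀) atTop (Icc 0 L) := by
  have hne : ∀ᵐ x : ℝ, x ≠ L := by simp [ae_iff, measure_singleton]
  have hT : Tendsto (fun k => ∫ s in (0 : ℝ)..L, |g k s - g₀ s|) atTop
      (𝓝 (∫ s in (0 : ℝ)..L, (0 : ℝ))) := by
    have hb' := ae_all_iff.2 hb
    rw [ae_restrict_iff' measurableSet_Ioo] at hb' hlim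
    refine tendsto_integral_filter_of_dominated_convergence (fun s => 2 * G s) ?_ ?_
      (hG.intervalIntegrable.const_mul 2) ?_
    · exact Eventually.of_forall fun k =>
        (((hg k).sub hg₀).intervalIntegrable.abs.def').aestronglyMeasurable
    · refine Eventually.of_forall fun k => ?_
      filter_upwards [hb', hlim, hne] with x h1 h2 h3 hx
      rw [uIoc_of_le hL.le] at hx
      have hxI : x ∈ Ioo 0 L := ⟨hx.1, lt_of_le_of_ne hx.2 h3⟩
      -- The limit inherits the bound `G`, whence `2 * G` dominates the difference.
      have h4 := le_of_tendsto (h2 hxI).abs (Eventually.of_forall fun k => h1 hxI k)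
      have h5 := h1 hxI k
      rw [Real.norm_eq_abs, abs_abs]
      refine (abs_sub _ _).trans ?_
      linarith
    · filter_upwards [hlim, hne] with x h2 h3 hx
      rw [uIoc_of_le hL.le] at hx
      have := ((h2 ⟨hx.1, lt_of_le_of_ne hx.2 h3⟩).sub_const (g₀ x)).abs
      simpa using this
  have hT2 := hT.const_mul (2 * L)
  simp only [intervalIntegral.integral_zero, mul_zero] at hT2
  rw [Metric.tendstoUniformlyOn_iff]
  intro ε hε
  filter_upwards [hT2.eventually (gt_mem_nhds hε)] with k hk x hx
  rw [dist_comm, Real.dist_eq, ← dirichletInv_sub L (hg k) hg₀]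
  exact (abs_dirichletInv_le ((hg k).sub hg₀) hx).trans_lt hk

/-! ### The zero function and the order of the sectors -/

lemma derivOn_zero_fun (L : ℝ) (k : ℕ) (x : ℝ) : derivOn L k (fun _ => 0) x = 0 := by
  simp [derivOn]

lemma isW41_zero (L : ℝ) : IsW41 L fun _ => 0 := by
  refine ⟨contDiffOn_const, ?_⟩
  rw [show derivOn L 3 (fun _ => 0) = fun _ => 0 from funext fun x => derivOn_zero_fun L 3 x]
  exact (contDiff_const (c := (0 : ℝ))).contDiffOn.absolutelyContinuousOnInterval

lemma navierBC_zero (L : ℝ) : NavierBC L fun _ => 0 :=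
  ⟨rfl, rfl, derivOn_zero_fun L 2 0, derivOn_zero_fun L 2 L⟩

lemma ae_restrict_Ioo_of_forall {L : ℝ} {P : ℝ → Prop} (h : ∀ x ∈ Ioo 0 L, P x) :
    ∀ᵐ x ∂(volume.restrict (Ioo 0 L)), P x :=
  (ae_restrict_iff' measurableSet_Ioo).2 (Eventually.of_forall h)

/-- The order of the sectors: `u ≤ v` and `u'' ≥ v''` on `[0, L]`. -/
def SectorLE (L : ℝ) (u v : ℝ → ℝ) : Prop :=
  ∀ x ∈ Icc 0 L, u x ≤ v x ∧ derivOn L 2 v x ≤ derivOn L 2 u x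

lemma SectorLE.refl (L : ℝ) (u : ℝ → ℝ) : SectorLE L u u := fun _ _ => ⟨le_rfl, le_rfl⟩

lemma SectorLE.integral_le {L : ℝ} (hL : 0 < L) {u v : ℝ → ℝ} (h : SectorLE L u v)
    (hu : ContinuousOn u (Icc 0 L)) (hv : ContinuousOn v (Icc 0 L)) :
    ∫ t in (0 : ℝ)..L, u t ≤ ∫ t in (0 : ℝ)..L, v t :=
  intervalIntegral.integral_mono_on hL.le (hu.intervalIntegrable_of_Icc hL.le)
    (hv.intervalIntegrable_of_Icc hL.le) fun x hx => (h x hx).1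

lemma IsW41.continuousOn {L : ℝ} {u : ℝ → ℝ} (hu : IsW41 L u) : ContinuousOn u (Icc 0 L) :=
  hu.1.continuousOn

lemma IsW41.continuousOn_derivOn_two {L : ℝ} (hL : 0 < L) {u : ℝ → ℝ} (hu : IsW41 L u) :
    ContinuousOn (derivOn L 2 u) (Icc 0 L) :=
  hu.1.continuousOn_iteratedDerivWithin (by norm_num) (uniqueDiffOn_Icc hL)

/-! ### The linear problem of one iteration step -/

namespace Bridge

variable (B : Bridge)

lemma a_pos : 0 < B.a := div_pos B.H_pos (mul_pos B.E_pos B.I_pos)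

lemma b_pos : 0 < B.b :=
  mul_pos (mul_pos (div_pos B.q_pos B.H_pos)
    (div_pos (mul_pos B.Ec_pos B.Ac_pos) (mul_pos B.E_pos B.I_pos))) (one_div_pos.2 B.Lc_pos)

lemma c_pos : 0 < B.c :=
  mul_pos (mul_pos (pow_pos (div_pos B.q_pos B.H_pos) 2)
    (div_pos (mul_pos B.Ec_pos B.Ac_pos) (mul_pos B.E_pos B.I_pos))) (one_div_pos.2 B.Lc_pos)

lemma lam_pos : 0 < B.lam := div_pos B.L_pos (by norm_num)

/-- The coefficient of `-v''` in the iteration. -/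
noncomputable def stepM : ℝ := B.a + 2 * B.b * B.lam * (B.L / Real.pi)

/-- The coefficient of `∫ v` in the iteration. -/
noncomputable def stepN : ℝ := B.c + B.b * B.lam * (Real.pi ^ 2 / B.L ^ 2)

lemma stepM_pos : 0 < B.stepM := by
  have := B.a_pos; have := B.b_pos; have := B.lam_pos; have := B.L_pos; have := Real.pi_pos
  unfold stepM; positivity

lemma stepN_pos : 0 < B.stepN := by
  have := B.c_pos; have := B.b_pos; have := B.lam_pos; have := B.L_pos; have := Real.pi_pos
  unfold stepN; positivity

/-- The condition under which the linear operator of the iteration satisfies a maximum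
principle. -/
def StepCond : Prop :=
  B.stepN * (6 * (√B.stepM * B.L) * Real.cosh (√B.stepM * B.L) + 6 * (√B.stepM * B.L)
    - 12 * Real.sinh (√B.stepM * B.L) - (√B.stepM * B.L) ^ 3) ≤ 12 * √B.stepM ^ 5

/-- The left-hand side of the equation of the iteration. -/
noncomputable def stepLHS (v : ℝ → ℝ) (x : ℝ) : ℝ :=
  derivOn B.L 4 v x - B.stepM * derivOn B.L 2 v x + B.stepN * ∫ t in (0 : ℝ)..B.L, v t

/-- The right-hand side of the equation of the iteration. -/
noncomputable def stepRHS (p u : ℝ → ℝ) (x : ℝ) : ℝ :=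
  p x / (B.E * B.I) + B.b * derivOn B.L 2 u x * (∫ t in (0 : ℝ)..B.L, u t)
    - 2 * B.b * B.lam * (B.L / Real.pi) * derivOn B.L 2 u x
    + B.b * B.lam * (Real.pi ^ 2 / B.L ^ 2) * ∫ t in (0 : ℝ)..B.L, u t

variable {B} {p : ℝ → ℝ}

lemma IsStep.ae_eq {u v : ℝ → ℝ} (h : B.IsStep p u v) :
    ∀ᵐ x ∂(volume.restrict (Ioo 0 B.L)), B.stepLHS v x = B.stepRHS p u x := h.2.2

/-- The equation of the iteration at a fixed point is the Melan equation. -/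
lemma stepLHS_sub_stepRHS (p w : ℝ → ℝ) (x : ℝ) :
    B.stepLHS w x - B.stepRHS p w x = (B.melanLHS w x - p x) / (B.E * B.I) := by
  have := B.E_pos.ne'; have := B.I_pos.ne'; have := B.H_pos.ne'; have := B.Lc_pos.ne'
  simp only [stepLHS, stepRHS, melanLHS, stepM, stepN, a, b, c]
  -- The terms added to both sides of the equation cancel in the difference, so their coefficients
  -- may stay opaque.
  generalize 2 * (B.q / B.H * (B.Ec * B.Ac / (B.E * B.I)) * (1 / B.Lc)) * B.lam *
    (B.L / Real.pi) = X
  generalize B.q / B.H * (B.Ec * B.Ac / (B.E * B.I)) * (1 / B.Lc) * B.lam *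
    (Real.pi ^ 2 / B.L ^ 2) = Y
  field_simp
  ring

lemma IsLowerSolution.stepLHS_le {w : ℝ → ℝ} (h : B.IsLowerSolution p w) :
    ∀ᵐ x ∂(volume.restrict (Ioo 0 B.L)), B.stepLHS w x ≤ B.stepRHS p w x := by
  filter_upwards [h.2.2] with x hx
  rw [← sub_nonpos, stepLHS_sub_stepRHS]
  exact div_nonpos_of_nonpos_of_nonneg (by linarith) (mul_pos B.E_pos B.I_pos).le

lemma IsUpperSolution.le_stepLHS {w : ℝ → ℝ} (h : B.IsUpperSolution p w) :
    ∀ᵐ x ∂(volume.restrict (Ioo 0 B.L)), B.stepRHS p w x ≤ B.stepLHS w x := by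
  filter_upwards [h.2.2] with x hx
  rw [← sub_nonneg, stepLHS_sub_stepRHS]
  exact div_nonneg (by linarith) (mul_pos B.E_pos B.I_pos).le

lemma melanLHS_eq_of_stepLHS_eq {w : ℝ → ℝ} {x : ℝ} (h : B.stepLHS w x = B.stepRHS p w x) :
    B.melanLHS w x = p x := by
  have h1 := stepLHS_sub_stepRHS (B := B) p w x
  rw [h, sub_self, eq_comm, div_eq_zero_iff] at h1
  rcases h1 with h1 | h1
  · linarith
  · exact absurd h1 (mul_pos B.E_pos B.I_pos).ne'

/-- Comparison for the linear operator of the iteration. -/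
lemma StepCond.comparison (hc : B.StepCond) {u₁ u₂ : ℝ → ℝ} (hu₁ : IsW41 B.L u₁)
    (bc₁ : NavierBC B.L u₁) (hu₂ : IsW41 B.L u₂) (bc₂ : NavierBC B.L u₂)
    (hle : ∀ᵐ x ∂(volume.restrict (Ioo 0 B.L)), B.stepLHS u₁ x ≤ B.stepLHS u₂ x) :
    SectorLE B.L u₁ u₂ := by
  refine navier_comparison B.L_pos (Real.sqrt_pos.2 B.stepM_pos) B.stepN_pos hc hu₁ bc₁ hu₂ bc₂ ?_
  rw [Real.sq_sqrt B.stepM_pos.le]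
  exact hle

lemma exists_isStep (hp : IntegrableOn p (Icc 0 B.L)) {u : ℝ → ℝ}
    (hu : ContinuousOn (derivOn B.L 2 u) (Icc 0 B.L)) : ∃ v, B.IsStep p u v := by
  have hint : IntegrableOn (B.stepRHS p u) (Icc 0 B.L) := by
    have h2 : IntegrableOn (derivOn B.L 2 u) (Icc 0 B.L) := hu.integrableOn_Icc
    have h3 : ∀ c : ℝ, IntegrableOn (fun _ => c) (Icc 0 B.L) := fun c =>
      continuousOn_const.integrableOn_Icc
    exact (((hp.div_const _).add ((h2.const_mul _).mul_const _)).sub (h2.const_mul _)).add (h3 _)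
  have hf : LocallyIntegrable ((Icc 0 B.L).indicator (B.stepRHS p u)) :=
    ((integrable_indicator_iff measurableSet_Icc).2 hint).locallyIntegrable
  obtain ⟨v, h1, h2, h3⟩ := exists_navier_solution B.L_pos (Real.sqrt_pos.2 B.stepM_pos)
    B.stepN_pos hf
  refine ⟨v, h1, h2, ?_⟩
  rw [Real.sq_sqrt B.stepM_pos.le] at h3
  filter_upwards [h3, ae_restrict_mem measurableSet_Ioo] with x hx hxI
  rw [indicator_of_mem (Ioo_subset_Icc_self hxI)] at hx
  exact hx

lemma stepRHS_congr {u₁ u₂ : ℝ → ℝ} (h : EqOn u₁ u₂ (Icc 0 B.L)) {x : ℝ} (hx : x ∈ Icc 0 B.L) :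
    B.stepRHS p u₁ x = B.stepRHS p u₂ x := by
  rw [stepRHS, stepRHS, derivOn_congr h 2 hx, integral_congr_Icc B.L_pos h]

lemma StepCond.isStep_unique (hc : B.StepCond) {u₁ u₂ v₁ v₂ : ℝ → ℝ} (h₁ : B.IsStep p u₁ v₁)
    (h₂ : B.IsStep p u₂ v₂) (hu : EqOn u₁ u₂ (Icc 0 B.L)) : EqOn v₁ v₂ (Icc 0 B.L) := by
  have key : ∀ᵐ x ∂(volume.restrict (Ioo 0 B.L)), B.stepLHS v₁ x = B.stepLHS v₂ x := by
    filter_upwards [h₁.ae_eq, h₂.ae_eq, ae_restrict_mem measurableSet_Ioo] with x e₁ e₂ hx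
    rw [e₁, e₂, stepRHS_congr hu (Ioo_subset_Icc_self hx)]
  have l₁ := hc.comparison h₁.1 h₁.2.1 h₂.1 h₂.2.1 (key.mono fun _ h => h.le)
  have l₂ := hc.comparison h₂.1 h₂.2.1 h₁.1 h₁.2.1 (key.mono fun _ h => h.ge)
  exact fun x hx => le_antisymm (l₁ x hx).1 (l₂ x hx).1

lemma exists_isTheIteration (hc : B.StepCond) (hp : IntegrableOn p (Icc 0 B.L)) {y₀ : ℝ → ℝ}
    (hy : IsW41 B.L y₀) :
    ∃ y : ℕ → ℝ → ℝ, y 0 = y₀ ∧ B.IsTheIteration p y₀ y := by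
  -- The implication makes the step a total function. Its arbitrary fallback is never met, since all
  -- iterates stay in `W^{4,1}`.
  have hex : ∀ u, ∃ v, ContinuousOn (derivOn B.L 2 u) (Icc 0 B.L) → B.IsStep p u v := by
    intro u
    by_cases hu : ContinuousOn (derivOn B.L 2 u) (Icc 0 B.L)
    · obtain ⟨v, hv⟩ := exists_isStep hp hu
      exact ⟨v, fun _ => hv⟩
    · exact ⟨u, fun h => absurd h hu⟩
  choose S hS using hex
  have hW : ∀ k, IsW41 B.L (S^[k] y₀) := by
    intro k
    induction k with
    | zero => exact hy
    | succ k ih =>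
      rw [Function.iterate_succ_apply']
      exact (hS _ (ih.continuousOn_derivOn_two B.L_pos)).1
  have hit : B.IsIteration p y₀ fun k => S^[k] y₀ := by
    refine ⟨fun _ _ => rfl, fun k => ?_⟩
    simp only [Function.iterate_succ_apply']
    exact hS _ ((hW k).continuousOn_derivOn_two B.L_pos)
  refine ⟨fun k => S^[k] y₀, rfl, hit, fun z hz k => ?_⟩
  induction k with
  | zero => exact hz.1
  | succ k ih => exact hc.isStep_unique (hz.2 k) (hit.2 k) ih

/-! ### The lower solution `0` and the upper solution `β` -/

lemma hasDerivAt_sin_mul (c x : ℝ) :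
    HasDerivAt (fun s => Real.sin (c * s)) (c * Real.cos (c * x)) x := by
  refine (((hasDerivAt_id x).const_mul c).sin).congr_deriv ?_
  simp [mul_comm]

lemma hasDerivAt_cos_mul (c x : ℝ) :
    HasDerivAt (fun s => Real.cos (c * s)) (-(c * Real.sin (c * x))) x := by
  refine (((hasDerivAt_id x).const_mul c).cos).congr_deriv ?_
  simp [mul_comm]

lemma derivOn_beta : ∀ x ∈ Icc 0 B.L,
    derivOn B.L 2 B.beta x = -(B.lam * (Real.pi / B.L) ^ 2 * Real.sin (Real.pi / B.L * x)) ∧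
    derivOn B.L 3 B.beta x = -(B.lam * (Real.pi / B.L) ^ 3 * Real.cos (Real.pi / B.L * x)) ∧
    derivOn B.L 4 B.beta x = B.lam * (Real.pi / B.L) ^ 4 * Real.sin (Real.pi / B.L * x) := by
  set c := Real.pi / B.L with hc
  have hL := B.L_pos
  have d0 : EqOn (derivOn B.L 0 B.beta) (fun x => B.lam * Real.sin (c * x)) (Icc 0 B.L) := by
    intro x _; simp only [derivOn, iteratedDerivWithin_zero]; rfl
  have d1 : EqOn (derivOn B.L 1 B.beta) (fun x => B.lam * c * Real.cos (c * x)) (Icc 0 B.L) :=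
    fun x hx => derivOn_succ_of_hasDerivAt hL hx d0
      (((hasDerivAt_sin_mul c x).const_mul B.lam).congr_deriv (by ring))
  have d2 : EqOn (derivOn B.L 2 B.beta) (fun x => -(B.lam * c ^ 2 * Real.sin (c * x)))
      (Icc 0 B.L) :=
    fun x hx => derivOn_succ_of_hasDerivAt hL hx d1
      (((hasDerivAt_cos_mul c x).const_mul (B.lam * c)).congr_deriv (by ring))
  have d3 : EqOn (derivOn B.L 3 B.beta) (fun x => -(B.lam * c ^ 3 * Real.cos (c * x)))
      (Icc 0 B.L) :=
    fun x hx => derivOn_succ_of_hasDerivAt hL hx d2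
      (((hasDerivAt_sin_mul c x).const_mul (B.lam * c ^ 2)).neg.congr_deriv (by ring))
  exact fun x hx => ⟨d2 hx, d3 hx, derivOn_succ_of_hasDerivAt hL hx d3
      (((hasDerivAt_cos_mul c x).const_mul (B.lam * c ^ 3)).neg.congr_deriv (by ring))⟩

lemma isW41_beta : IsW41 B.L B.beta := by
  constructor
  · apply ContDiff.contDiffOn
    unfold beta
    fun_prop
  · have h : AbsolutelyContinuousOnInterval
        (fun x => -(B.lam * (Real.pi / B.L) ^ 3 * Real.cos (Real.pi / B.L * x))) 0 B.L := by
      apply ContDiffOn.absolutelyContinuousOnInterval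
      apply ContDiff.contDiffOn
      fun_prop
    refine h.congr ?_
    rw [uIcc_of_le B.L_pos.le]
    exact fun x hx => ((derivOn_beta x hx).2.1).symm

lemma navierBC_beta : NavierBC B.L B.beta := by
  have hL := B.L_pos
  refine ⟨by simp [beta], by simp [beta, hL.ne'], ?_, ?_⟩
  · simp [(derivOn_beta 0 (left_mem_Icc.2 hL.le)).1]
  · simp [(derivOn_beta B.L (right_mem_Icc.2 hL.le)).1, hL.ne']

lemma integral_beta : ∫ t in (0 : ℝ)..B.L, B.beta t = 2 * B.lam * (B.L / Real.pi) := by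
  have hL := B.L_pos.ne'
  have hpi := Real.pi_ne_zero
  rw [integral_eq_sub_of_hasDerivAt
    (f := fun s => -(B.lam * (B.L / Real.pi) * Real.cos (Real.pi / B.L * s)))
    (fun s _ => (((hasDerivAt_cos_mul (Real.pi / B.L) s).const_mul
      (B.lam * (B.L / Real.pi))).neg).congr_deriv (by rw [beta]; field_simp))
    ((isW41_beta (B := B)).continuousOn.intervalIntegrable_of_Icc B.L_pos.le)]
  simp [hL]
  ring

lemma sin_nonneg_of_mem {x : ℝ} (hx : x ∈ Icc 0 B.L) : 0 ≤ Real.sin (Real.pi / B.L * x) := by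
  have hL := B.L_pos
  apply Real.sin_nonneg_of_nonneg_of_le_pi
  · have := hx.1; have := Real.pi_pos; positivity
  · rw [div_mul_eq_mul_div, div_le_iff₀ hL]
    exact mul_le_mul_of_nonneg_left hx.2 Real.pi_pos.le

lemma sectorLE_zero_beta : SectorLE B.L (fun _ => 0) B.beta := by
  intro x hx
  have h1 := sin_nonneg_of_mem hx
  have := B.lam_pos
  have := B.L_pos
  rw [derivOn_zero_fun, (derivOn_beta x hx).1]
  exact ⟨mul_nonneg B.lam_pos.le h1, neg_nonpos.2 (by positivity)⟩

lemma isLowerSolution_zero (hp : ∀ᵐ x ∂(volume.restrict (Ioo 0 B.L)), 0 ≤ p x) :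
    B.IsLowerSolution p fun _ => 0 := by
  refine ⟨isW41_zero _, navierBC_zero _, ?_⟩
  filter_upwards [hp] with x hx
  simpa [melanLHS, derivOn_zero_fun] using hx

lemma isUpperSolution_beta (hp_le : ∀ᵐ x ∂(volume.restrict (Set.Ioo 0 B.L)),
      p x ≤ (Real.pi ^ 4 / (100 * B.L ^ 3) * (B.E * B.I) + B.H * Real.pi ^ 2 / (100 * B.L)
            + B.q / B.H * (B.Ec * B.Ac / B.Lc) * (Real.pi * B.L / 5000))
              * Real.sin (Real.pi / B.L * x)
          + 2 * (B.q / B.H) ^ 2 * (B.Ec * B.Ac / B.Lc) * (B.L ^ 2 / (100 * Real.pi))) :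
    B.IsUpperSolution p B.beta := by
  refine ⟨isW41_beta, navierBC_beta, ?_⟩
  filter_upwards [hp_le, ae_restrict_mem measurableSet_Ioo] with x hx hxI
  obtain ⟨h2, -, h4⟩ := derivOn_beta x (Ioo_subset_Icc_self hxI)
  refine hx.trans (le_of_eq ?_)
  rw [melanLHS, integral_beta, h2, h4, lam]
  have := B.L_pos.ne'; have := B.H_pos.ne'; have := B.Lc_pos.ne'; have := Real.pi_ne_zero
  generalize Real.sin (Real.pi / B.L * x) = s
  field_simp
  ring

end Bridge

/-! ### Invariance of the sector and monotonicity of the iteration -/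

namespace Bridge

variable {B : Bridge} {p : ℝ → ℝ}

/-- `u ∈ W^{4,1}[0, L]` satisfies the boundary conditions and lies in the sector `[0, β]`. -/
structure InSector (B : Bridge) (u : ℝ → ℝ) : Prop where
  isW41 : IsW41 B.L u
  navierBC : NavierBC B.L u
  zero_le : SectorLE B.L (fun _ => 0) u
  le_beta : SectorLE B.L u B.beta

lemma inSector_zero : InSector B fun _ => 0 :=
  ⟨isW41_zero _, navierBC_zero _, .refl _ _, sectorLE_zero_beta⟩

lemma inSector_beta : InSector B B.beta :=
  ⟨isW41_beta, navierBC_beta, sectorLE_zero_beta, .refl _ _⟩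

lemma InSector.mem_sector {u : ℝ → ℝ} (h : InSector B u) : u ∈ sector B.L (fun _ => 0) B.beta :=
  ⟨h.isW41.1.of_le (by norm_num), fun x hx =>
    ⟨(h.zero_le x hx).1, (h.le_beta x hx).1, (h.zero_le x hx).2, (h.le_beta x hx).2⟩⟩

lemma IsSolution.inSector {u : ℝ → ℝ} (h : B.IsSolution p u)
    (hu : u ∈ sector B.L (fun _ => 0) B.beta) : InSector B u :=
  ⟨h.1, h.2.1, fun x hx => ⟨(hu.2 x hx).1, (hu.2 x hx).2.2.1⟩,
    fun x hx => ⟨(hu.2 x hx).2.1, (hu.2 x hx).2.2.2⟩⟩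

lemma InSector.derivOn_two_nonpos {u : ℝ → ℝ} (h : InSector B u) {x : ℝ} (hx : x ∈ Icc 0 B.L) :
    derivOn B.L 2 u x ≤ 0 := by
  simpa [derivOn_zero_fun] using (h.zero_le x hx).2

lemma InSector.le_derivOn_two {u : ℝ → ℝ} (h : InSector B u) {x : ℝ} (hx : x ∈ Icc 0 B.L) :
    -(B.lam * (Real.pi ^ 2 / B.L ^ 2)) ≤ derivOn B.L 2 u x := by
  refine le_trans ?_ (h.le_beta x hx).2
  rw [(derivOn_beta x hx).1, div_pow, neg_le_neg_iff]
  have := B.lam_pos; have := B.L_pos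
  exact mul_le_of_le_one_right (by positivity) (Real.sin_le_one _)

lemma InSector.integral_le {u : ℝ → ℝ} (h : InSector B u) :
    ∫ t in (0 : ℝ)..B.L, u t ≤ 2 * B.lam * (B.L / Real.pi) := by
  rw [← integral_beta]
  exact h.le_beta.integral_le B.L_pos h.isW41.continuousOn isW41_beta.continuousOn

lemma InSector.integral_nonneg {u : ℝ → ℝ} (h : InSector B u) :
    0 ≤ ∫ t in (0 : ℝ)..B.L, u t :=
  intervalIntegral.integral_nonneg B.L_pos.le fun x hx => (h.zero_le x hx).1

/-- The right-hand side of the iteration is monotone on the sector. -/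
lemma stepRHS_mono {u₁ u₂ : ℝ → ℝ} (h₁ : InSector B u₁) (h₂ : InSector B u₂)
    (h : SectorLE B.L u₁ u₂) {x : ℝ} (hx : x ∈ Icc 0 B.L) :
    B.stepRHS p u₁ x ≤ B.stepRHS p u₂ x := by
  have hI := h.integral_le B.L_pos h₁.isW41.continuousOn h₂.isW41.continuousOn
  have hI2 := h₂.integral_le
  have hd := (h x hx).2
  have hd1 := h₁.le_derivOn_two hx
  simp only [stepRHS]
  set I₁ := ∫ t in (0 : ℝ)..B.L, u₁ t
  set I₂ := ∫ t in (0 : ℝ)..B.L, u₂ t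
  -- The difference of the right-hand sides is `b` times the sum of the two products `e1` and `e2`.
  -- They are nonnegative because in the sector `∫ u₂ ≤ ∫ β = 2 λ L / π` and `u₁'' ≥ -λ π² / L²`,
  -- which explains the coefficients added in the iteration.
  have e1 : 0 ≤ (derivOn B.L 2 u₁ x - derivOn B.L 2 u₂ x) * (2 * B.lam * (B.L / Real.pi) - I₂) :=
    mul_nonneg (by linarith) (by linarith)
  have e2 : 0 ≤ (derivOn B.L 2 u₁ x + B.lam * (Real.pi ^ 2 / B.L ^ 2)) * (I₂ - I₁) :=
    mul_nonneg (by linarith) (by linarith)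
  have e3 := mul_nonneg B.b_pos.le (add_nonneg e1 e2)
  linarith

lemma StepCond.isStep_mono (hc : B.StepCond) {u₁ u₂ v₁ v₂ : ℝ → ℝ} (h₁ : InSector B u₁)
    (h₂ : InSector B u₂) (h : SectorLE B.L u₁ u₂) (s₁ : B.IsStep p u₁ v₁)
    (s₂ : B.IsStep p u₂ v₂) : SectorLE B.L v₁ v₂ := by
  refine hc.comparison s₁.1 s₁.2.1 s₂.1 s₂.2.1 ?_
  filter_upwards [s₁.ae_eq, s₂.ae_eq, ae_restrict_mem measurableSet_Ioo] with x e₁ e₂ hx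
  rw [e₁, e₂]
  exact stepRHS_mono h₁ h₂ h (Ioo_subset_Icc_self hx)

/-- A lower solution has its linear left-hand side below its own right-hand side; monotonicity
raises the latter to the right-hand side at `u`, and comparison concludes. -/
lemma StepCond.zero_le_of_isStep (hc : B.StepCond) (hl : B.IsLowerSolution p fun _ => 0)
    {u v : ℝ → ℝ} (h : InSector B u) (s : B.IsStep p u v) : SectorLE B.L (fun _ => 0) v := by
  refine hc.comparison (isW41_zero _) (navierBC_zero _) s.1 s.2.1 ?_
  filter_upwards [s.ae_eq, hl.stepLHS_le, ae_restrict_mem measurableSet_Ioo] with x e₁ e₂ hx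
  rw [e₁]
  exact e₂.trans (stepRHS_mono inSector_zero h h.zero_le (Ioo_subset_Icc_self hx))

lemma StepCond.le_beta_of_isStep (hc : B.StepCond) (hb : B.IsUpperSolution p B.beta)
    {u v : ℝ → ℝ} (h : InSector B u) (s : B.IsStep p u v) : SectorLE B.L v B.beta := by
  refine hc.comparison s.1 s.2.1 isW41_beta navierBC_beta ?_
  filter_upwards [s.ae_eq, hb.le_stepLHS, ae_restrict_mem measurableSet_Ioo] with x e₁ e₂ hx
  rw [e₁]
  exact (stepRHS_mono h inSector_beta h.le_beta (Ioo_subset_Icc_self hx)).trans e₂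

lemma StepCond.inSector_of_isStep (hc : B.StepCond) (hl : B.IsLowerSolution p fun _ => 0)
    (hb : B.IsUpperSolution p B.beta) {u v : ℝ → ℝ} (h : InSector B u) (s : B.IsStep p u v) :
    InSector B v :=
  ⟨s.1, s.2.1, hc.zero_le_of_isStep hl h s, hc.le_beta_of_isStep hb h s⟩

/-! ### Limits of the iterates -/

/-- If the second derivatives of the iterates converge pointwise, then the iterates converge
uniformly to a solution. -/
lemma exists_solution_of_tendsto (hp : IntegrableOn p (Icc 0 B.L)) {u : ℕ → ℝ → ℝ}
    (hs : ∀ k, B.IsStep p (u k) (u (k + 1))) (hu : ∀ k, InSector B (u k))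
    (hlim : ∀ x ∈ Icc 0 B.L, ∃ l, Tendsto (fun k => derivOn B.L 2 (u k) x) atTop (𝓝 l)) :
    ∃ y, B.IsSolution p y ∧ InSector B y ∧ TendstoUniformlyOn u y atTop (Icc 0 B.L) := by
  have hL := B.L_pos
  choose h hh hu1 hu2 hu4 using fun k =>
    exists_dirichletInv_of_isW41 hL (hu k).isW41 (hu k).navierBC
  choose! l hl using hlim
  set C := B.lam * (Real.pi ^ 2 / B.L ^ 2) with hC
  set v : ℕ → ℝ → ℝ := fun k => dirichletInv B.L (h k) with hvdef
  have hvc : ∀ k, Continuous (v k) := fun k => continuous_dirichletInv B.L (hh k)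
  have hv0 : ∀ k, ∀ x ∈ Icc 0 B.L, derivOn B.L 2 (u k) x = - v k x := fun k x hx => hu2 k hx
  have hvC : ∀ k, ∀ x ∈ Icc 0 B.L, |v k x| ≤ C := by
    intro k x hx
    have h1 := (hu k).derivOn_two_nonpos hx
    have h2 := (hu k).le_derivOn_two hx
    rw [hv0 k x hx] at h1 h2
    rw [abs_le]
    constructor <;> linarith
  -- the limit of the second derivatives
  set V : ℝ → ℝ := (Icc 0 B.L).indicator fun x => - l x with hV
  have hVt : ∀ x ∈ Icc 0 B.L, Tendsto (fun k => v k x) atTop (𝓝 (V x)) := by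
    intro x hx
    rw [hV, indicator_of_mem hx]
    have := (hl x hx).neg
    simpa only [hv0 _ x hx, neg_neg] using this
  have hVC : ∀ x ∈ Icc 0 B.L, |V x| ≤ C := fun x hx =>
    le_of_tendsto (hVt x hx).abs (Eventually.of_forall fun k => hvC k x hx)
  -- Pointwise convergence only yields a bounded measurable limit; its regularity is recovered later
  -- from `V = R h₀`.
  have hVm : Measurable V := by
    refine measurable_of_tendsto_metrizable
      (f := fun k => (Icc 0 B.L).indicator (v k))
      (fun k => (hvc k).measurable.indicator measurableSet_Icc) (tendsto_pi_nhds.2 fun x => ?_)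
    by_cases hx : x ∈ Icc 0 B.L
    · simpa only [indicator_of_mem hx] using hVt x hx
    · simp only [hV, indicator_of_notMem hx]
      exact tendsto_const_nhds
  have hVon : IntegrableOn V (Icc 0 B.L) :=
    Measure.integrableOn_of_bounded (M := C) (by simp) hVm.aestronglyMeasurable
      ((ae_restrict_iff' measurableSet_Icc).2 (Eventually.of_forall fun x hx => hVC x hx))
  have hVi : LocallyIntegrable V := by
    have := ((integrable_indicator_iff measurableSet_Icc).2 hVon).locallyIntegrable
    rwa [hV, indicator_indicator, inter_self] at this
  have hU : TendstoUniformlyOn (fun k => dirichletInv B.L (v k)) (dirichletInv B.L V) atTop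
      (Icc 0 B.L) :=
    tendstoUniformlyOn_dirichletInv hL (G := fun _ => C) (fun k => (hvc k).locallyIntegrable) hVi
      (locallyIntegrable_const C)
      (fun k => ae_restrict_Ioo_of_forall fun x hx => hvC k x (Ioo_subset_Icc_self hx))
      (ae_restrict_Ioo_of_forall fun x hx => hVt x (Ioo_subset_Icc_self hx))
  have hUu : TendstoUniformlyOn u (dirichletInv B.L V) atTop (Icc 0 B.L) :=
    hU.congr (Eventually.of_forall fun k => (hu1 k).symm)
  set J : ℝ := ∫ t in (0 : ℝ)..B.L, dirichletInv B.L V t with hJ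
  have hJt : Tendsto (fun k => ∫ t in (0 : ℝ)..B.L, u k t) atTop (𝓝 J) := by
    refine TendstoUniformlyOn.tendsto_intervalIntegral_of_continuousOn
      (Eventually.of_forall fun k => ?_) ?_
    · rw [uIcc_of_le hL.le]; exact (hu k).isW41.continuousOn
    · rwa [uIcc_of_le hL.le]
  -- the limit of the fourth derivatives
  set Λ := 2 * B.b * B.lam * (B.L / Real.pi) with hΛ
  set ρ := B.b * B.lam * (Real.pi ^ 2 / B.L ^ 2) with hρ
  have hae : ∀ k, ∀ᵐ x ∂(volume.restrict (Ioo 0 B.L)), h (k + 1) x =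
      p x / (B.E * B.I) + (B.b * -v k x * (∫ t in (0 : ℝ)..B.L, u k t) - Λ * -v k x
        + ρ * (∫ t in (0 : ℝ)..B.L, u k t) - B.stepM * v (k + 1) x
        - B.stepN * ∫ t in (0 : ℝ)..B.L, u (k + 1) t) := by
    intro k
    filter_upwards [(hs k).ae_eq, hu4 (k + 1), ae_restrict_mem measurableSet_Ioo] with x e₁ e₂ hx
    rw [stepLHS, stepRHS, e₂, hv0 k x (Ioo_subset_Icc_self hx),
      hv0 (k + 1) x (Ioo_subset_Icc_self hx)] at e₁
    linarith
  set h₀ : ℝ → ℝ := fun x => (Icc 0 B.L).indicator p x / (B.E * B.I) + (B.b * -V x * J - Λ * -V x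
    + ρ * J - B.stepM * V x - B.stepN * J) with hh₀
  have hpd : Integrable fun x => (Icc 0 B.L).indicator p x / (B.E * B.I) :=
    ((integrable_indicator_iff measurableSet_Icc).2 hp).div_const _
  have hh₀i : LocallyIntegrable h₀ := by
    have h1 : LocallyIntegrable fun x => (-B.b * J + Λ - B.stepM) * V x :=
      hVi.continuous_smul (g := fun _ => -B.b * J + Λ - B.stepM) continuous_const
    have h2 := hpd.locallyIntegrable.add (h1.add (locallyIntegrable_const (ρ * J - B.stepN * J)))
    have h3 : h₀ = fun x => (Icc 0 B.L).indicator p x / (B.E * B.I) +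
        ((-B.b * J + Λ - B.stepM) * V x + (ρ * J - B.stepN * J)) := by
      ext x
      simp only [hh₀]
      ring
    rw [h3]
    exact h2
  set J' := 2 * B.lam * (B.L / Real.pi) with hJ'
  have hJb : ∀ k, |∫ t in (0 : ℝ)..B.L, u k t| ≤ J' := fun k => by
    rw [abs_of_nonneg (hu k).integral_nonneg]
    exact (hu k).integral_le
  have hRt : TendstoUniformlyOn (fun k => dirichletInv B.L (h (k + 1))) (dirichletInv B.L h₀) atTop
      (Icc 0 B.L) := by
    -- The fourth derivatives need not be bounded, as `p` is merely integrable, but they differ from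
    -- `p / (EI)` by a uniformly bounded term.
    refine tendstoUniformlyOn_dirichletInv hL (G := fun x =>
      |(Icc 0 B.L).indicator p x / (B.E * B.I)| + (|B.b| * C * J' + |Λ| * C + |ρ| * J' + |B.stepM| * C + |B.stepN| * J'))
      (fun k => hh (k + 1)) hh₀i ?_ (fun k => ?_) ?_
    · exact hpd.abs.locallyIntegrable.add (locallyIntegrable_const _)
    · filter_upwards [hae k, ae_restrict_mem measurableSet_Ioo] with x hx hxI
      have hxc := Ioo_subset_Icc_self hxI
      rw [hx, indicator_of_mem hxc]
      have b1 : |B.b * -v k x * ∫ t in (0 : ℝ)..B.L, u k t| ≤ |B.b| * C * J' := by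
        rw [abs_mul, abs_mul, abs_neg]
        have := hvC k x hxc
        have hC0 : 0 ≤ C := (abs_nonneg _).trans this
        have := hJb k
        gcongr
      have b2 : |Λ * -v k x| ≤ |Λ| * C := by
        rw [abs_mul, abs_neg]
        have := hvC k x hxc
        gcongr
      have b3 : |ρ * ∫ t in (0 : ℝ)..B.L, u k t| ≤ |ρ| * J' := by
        rw [abs_mul]
        have := hJb k
        gcongr
      have b4 : |B.stepM * v (k + 1) x| ≤ |B.stepM| * C := by
        rw [abs_mul]
        have := hvC (k + 1) x hxc
        gcongr
      have b5 : |B.stepN * ∫ t in (0 : ℝ)..B.L, u (k + 1) t| ≤ |B.stepN| * J' := by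
        rw [abs_mul]
        have := hJb (k + 1)
        gcongr
      refine (abs_add_le _ _).trans (add_le_add le_rfl ?_)
      rw [abs_le] at b1 b2 b3 b4 b5 ⊢
      constructor <;> linarith
    · filter_upwards [ae_all_iff.2 hae, ae_restrict_mem measurableSet_Ioo] with x hx hxI
      have hxc := Ioo_subset_Icc_self hxI
      have t1 := hVt x hxc
      have t2 := (tendsto_add_atTop_iff_nat 1).2 t1
      have t3 := (tendsto_add_atTop_iff_nat 1).2 hJt
      simp only [hx, hh₀, indicator_of_mem hxc]
      exact tendsto_const_nhds.add ((((((t1.neg.const_mul B.b).mul hJt).sub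
        (t1.neg.const_mul Λ)).add (hJt.const_mul ρ)).sub (t2.const_mul B.stepM)).sub
        (t3.const_mul B.stepN))
  -- Two limits of `-u_k''` are identified: the pointwise one, and the one obtained from the
  -- convergent fourth derivatives.
  have hVR : EqOn V (dirichletInv B.L h₀) (Icc 0 B.L) := fun x hx =>
    tendsto_nhds_unique ((tendsto_add_atTop_iff_nat 1).2 (hVt x hx)) (hRt.tendsto_at hx)
  -- the limit solves the problem
  set y := dirichletInv B.L (dirichletInv B.L h₀) with hy
  have hyU : EqOn (dirichletInv B.L V) y (Icc 0 B.L) := fun x hx => dirichletInv_congr hVR hx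
  have hyW : IsW41 B.L y := isW41_dirichletInv_dirichletInv hL hh₀i
  have hyB : NavierBC B.L y := navierBC_dirichletInv_dirichletInv hL hh₀i
  have hy2 : ∀ x ∈ Icc 0 B.L, derivOn B.L 2 y x = - V x := fun x hx => by
    rw [hVR hx]; exact derivOn_two_dirichletInv hL (continuous_dirichletInv B.L hh₀i) hx
  have hyt : TendstoUniformlyOn u y atTop (Icc 0 B.L) := hUu.congr_right hyU
  have hyt2 : ∀ x ∈ Icc 0 B.L,
      Tendsto (fun k => derivOn B.L 2 (u k) x) atTop (𝓝 (derivOn B.L 2 y x)) := fun x hx => by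
    rw [hy2 x hx]
    simpa only [hv0 _ x hx] using (hVt x hx).neg
  refine ⟨y, ⟨hyW, hyB, ?_⟩, ⟨hyW, hyB, fun x hx => ⟨?_, ?_⟩, fun x hx => ⟨?_, ?_⟩⟩, hyt⟩
  · filter_upwards [derivOn_four_dirichletInv_dirichletInv hL hh₀i,
      ae_restrict_mem measurableSet_Ioo] with x hx hxI
    have hxc := Ioo_subset_Icc_self hxI
    apply melanLHS_eq_of_stepLHS_eq
    rw [stepLHS, stepRHS, hx, hy2 x hxc, ← integral_congr_Icc hL hyU, ← hJ, ← hΛ, ← hρ]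
    simp only [hh₀, indicator_of_mem hxc]
    ring
  · exact ge_of_tendsto (hyt.tendsto_at hx) (Eventually.of_forall fun k => ((hu k).zero_le x hx).1)
  · exact le_of_tendsto (hyt2 x hx) (Eventually.of_forall fun k => ((hu k).zero_le x hx).2)
  · exact le_of_tendsto (hyt.tendsto_at hx) (Eventually.of_forall fun k => ((hu k).le_beta x hx).1)
  · exact ge_of_tendsto (hyt2 x hx) (Eventually.of_forall fun k => ((hu k).le_beta x hx).2)

/-! ### Uniqueness and positivity -/

lemma IsSolution.le_of_integral_le {y₁ y₂ : ℝ → ℝ} (s₁ : B.IsSolution p y₁)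
    (s₂ : B.IsSolution p y₂) (h₁ : InSector B y₁) (h₂ : InSector B y₂)
    (hI : ∫ t in (0 : ℝ)..B.L, y₁ t ≤ ∫ t in (0 : ℝ)..B.L, y₂ t) :
    ∀ x ∈ Icc 0 B.L, y₂ x ≤ y₁ x := by
  have hL := B.L_pos
  obtain ⟨f₁, i₁, e₁, d₁, g₁⟩ := exists_dirichletInv_of_isW41 hL h₁.isW41 h₁.navierBC
  obtain ⟨f₂, i₂, e₂, d₂, g₂⟩ := exists_dirichletInv_of_isW41 hL h₂.isW41 h₂.navierBC
  set I₁ := ∫ t in (0 : ℝ)..B.L, y₁ t with hI₁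
  set I₂ := ∫ t in (0 : ℝ)..B.L, y₂ t with hI₂
  have hI20 : 0 ≤ I₂ := h₂.integral_nonneg
  have hEI := mul_pos B.E_pos B.I_pos
  set e := B.Ec * B.Ac / B.Lc with he
  have he0 : 0 < e := div_pos (mul_pos B.Ec_pos B.Ac_pos) B.Lc_pos
  have hqH : 0 < B.q / B.H := div_pos B.q_pos B.H_pos
  set κ := (B.H + e * (B.q / B.H) * I₂) / (B.E * B.I) with hκ
  have hκ0 : 0 < κ := by
    have := B.H_pos
    positivity
  have c₁ := continuous_dirichletInv B.L i₁
  have c₂ := continuous_dirichletInv B.L i₂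
  have hv : dirichletInv B.L (fun s => f₁ s - f₂ s) =
      fun x => dirichletInv B.L f₁ x - dirichletInv B.L f₂ x :=
    funext fun x => dirichletInv_sub B.L i₁ i₂ x
  have hpos : ∀ x ∈ Icc 0 B.L, 0 ≤ dirichletInv B.L f₁ x - dirichletInv B.L f₂ x := by
    intro x hx
    have := dirichletInv_nonneg_of_ae hL (Real.sqrt_pos.2 hκ0) (i₁.sub i₂) (x := x) ?_ hx
    · rw [show f₁ - f₂ = fun s => f₁ s - f₂ s from rfl, hv] at this
      exact this
    rw [show f₁ - f₂ = fun s => f₁ s - f₂ s from rfl, hv, Real.sq_sqrt hκ0.le]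
    filter_upwards [s₁.2.2, s₂.2.2, g₁, g₂, ae_restrict_mem measurableSet_Ioo]
      with z a₁ a₂ b₁ b₂ hz
    have hzc := Ioo_subset_Icc_self hz
    have hn := h₁.derivOn_two_nonpos hzc
    rw [d₁ hzc] at hn
    rw [melanLHS, b₁, d₁ hzc, ← hI₁, ← he] at a₁
    rw [melanLHS, b₂, d₂ hzc, ← hI₂, ← he] at a₂
    simp only at a₁ a₂ hn
    -- Subtract the equations with the coefficient of `w''` frozen at `I₂`. What remains is `I₂ - I₁
    -- ≥ 0` times a nonnegative factor, because `-y₁'' ≥ 0`; the local maximum principle with `m² =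
    -- κ` then applies.
    have key : B.E * B.I * (f₁ z - f₂ z + κ * (dirichletInv B.L f₁ z - dirichletInv B.L f₂ z)) =
        e * (B.q / B.H) * (I₂ - I₁) * dirichletInv B.L f₁ z +
          B.q ^ 2 / B.H ^ 2 * e * (I₂ - I₁) := by
      have hκ' : B.E * B.I * κ = B.H + e * (B.q / B.H) * I₂ := by
        rw [mul_comm, hκ, div_mul_cancel₀ _ hEI.ne']
      linear_combination (dirichletInv B.L f₁ z - dirichletInv B.L f₂ z) * hκ' + a₁ - a₂
    have hr : 0 ≤ e * (B.q / B.H) * (I₂ - I₁) * dirichletInv B.L f₁ z +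
          B.q ^ 2 / B.H ^ 2 * e * (I₂ - I₁) := by
      have q1 : 0 ≤ I₂ - I₁ := by linarith
      have q2 : 0 ≤ dirichletInv B.L f₁ z := by linarith
      positivity
    rw [← key] at hr
    exact nonneg_of_mul_nonneg_right hr hEI
  intro x hx
  have h3 := dirichletInv_nonneg (c₁.sub c₂).locallyIntegrable hpos hx
  rw [show (dirichletInv B.L f₁ - dirichletInv B.L f₂) =
    fun s => dirichletInv B.L f₁ s - dirichletInv B.L f₂ s from rfl,
    dirichletInv_sub B.L c₁.locallyIntegrable c₂.locallyIntegrable] at h3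
  rw [e₁ hx, e₂ hx]
  linarith

/-- Ordered integrals give the reverse pointwise order, hence equal integrals; the previous lemma
then applies in both directions. -/
lemma IsSolution.eqOn {y₁ y₂ : ℝ → ℝ} (s₁ : B.IsSolution p y₁)
    (s₂ : B.IsSolution p y₂) (h₁ : InSector B y₁) (h₂ : InSector B y₂) :
    EqOn y₁ y₂ (Icc 0 B.L) := by
  wlog hI : ∫ t in (0 : ℝ)..B.L, y₁ t ≤ ∫ t in (0 : ℝ)..B.L, y₂ t generalizing y₁ y₂
  · exact (this s₂ s₁ h₂ h₁ (le_of_not_ge hI)).symm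
  have l₁ := s₁.le_of_integral_le s₂ h₁ h₂ hI
  have hI' : ∫ t in (0 : ℝ)..B.L, y₂ t ≤ ∫ t in (0 : ℝ)..B.L, y₁ t :=
    intervalIntegral.integral_mono_on B.L_pos.le
      (h₂.isW41.continuousOn.intervalIntegrable_of_Icc B.L_pos.le)
      (h₁.isW41.continuousOn.intervalIntegrable_of_Icc B.L_pos.le) l₁
  have l₂ := s₂.le_of_integral_le s₁ h₂ h₁ hI'
  exact fun x hx => le_antisymm (l₂ x hx) (l₁ x hx)

/-- The solution is nonnegative, concave and zero at both ends. A zero in the interior would make it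
vanish identically, and the equation would give `p = 0` almost everywhere. -/
lemma IsSolution.pos {y : ℝ → ℝ} (s : B.IsSolution p y) (h : InSector B y)
    (hp : ¬ ∀ᵐ x ∂(volume.restrict (Ioo 0 B.L)), p x = 0) : ∀ x ∈ Ioo 0 B.L, 0 < y x := by
  have hL := B.L_pos
  by_contra! hcon
  obtain ⟨x₀, hx₀, hy₀⟩ := hcon
  apply hp
  obtain ⟨f, i, e, d, -⟩ := exists_dirichletInv_of_isW41 hL h.isW41 h.navierBC
  have hconc : ConcaveOn ℝ (Icc 0 B.L) y := by
    refine (concaveOn_dirichletInv (continuous_dirichletInv B.L i).locallyIntegrable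
      fun x hx => ?_).congr e.symm
    have := h.derivOn_two_nonpos hx
    rw [d hx] at this
    simp only at this
    linarith
  have hzero : EqOn y (fun _ => 0) (Icc 0 B.L) := by
    intro x hx
    have hx0 : 0 ≤ y x := (h.zero_le x hx).1
    refine le_antisymm ?_ hx0
    by_contra! hpos
    rcases lt_trichotomy x x₀ with hlt | rfl | hgt
    · have hm : x₀ ∈ openSegment ℝ x B.L := by
        rw [openSegment_eq_Ioo (hlt.trans hx₀.2)]; exact ⟨hlt, hx₀.2⟩
      obtain ⟨α, β, hα, hβ, hαβ, hxe⟩ := hm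
      have := hconc.2 hx (right_mem_Icc.2 hL.le) hα.le hβ.le hαβ
      rw [hxe, h.navierBC.2.1, smul_zero, add_zero, smul_eq_mul] at this
      have := mul_pos hα hpos
      linarith
    · linarith
    · have hm : x₀ ∈ openSegment ℝ 0 x := by
        rw [openSegment_eq_Ioo (hx₀.1.trans hgt)]; exact ⟨hx₀.1, hgt⟩
      obtain ⟨α, β, hα, hβ, hαβ, hxe⟩ := hm
      have := hconc.2 (left_mem_Icc.2 hL.le) hx hα.le hβ.le hαβ
      rw [hxe, h.navierBC.1, smul_zero, zero_add, smul_eq_mul] at this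
      have := mul_pos hβ hpos
      linarith
  filter_upwards [s.2.2, ae_restrict_mem measurableSet_Ioo] with x hx hxI
  have hxc := Ioo_subset_Icc_self hxI
  rw [← hx, melanLHS, derivOn_congr hzero 4 hxc, derivOn_congr hzero 2 hxc,
    integral_congr_Icc hL hzero]
  simp [derivOn_zero_fun]

/-! ### From the hypothesis on `σ` to the maximum principle -/

/-- The condition `N ≤ 4 M / L³ σ(√M L)` implies the maximum principle for the iteration. -/
lemma stepCond_of_le {n : ℝ} (hn : B.q / B.H = 8 * n / B.L)
    (hle : B.c * (1 + Real.pi ^ 2 / (800 * n)) ≤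
      4 * (B.a + B.c * B.L ^ 3 / (400 * n * Real.pi)) / B.L ^ 3 *
        melanSigma (√(B.a + B.c * B.L ^ 3 / (400 * n * Real.pi)) * B.L)) : B.StepCond := by
  have hL := B.L_pos
  have hn0 : 0 < n := by
    have := div_pos B.q_pos B.H_pos
    rw [hn, div_pos_iff_of_pos_right hL] at this
    linarith
  have hcb : B.c = B.b * (8 * n / B.L) := by
    rw [← hn, c, b]; ring
  have hM : B.a + B.c * B.L ^ 3 / (400 * n * Real.pi) = B.stepM := by
    rw [stepM, hcb, lam]
    have := Real.pi_ne_zero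
    field_simp
    ring
  have hN : B.c * (1 + Real.pi ^ 2 / (800 * n)) = B.stepN := by
    rw [stepN, mul_add, mul_one]
    congr 1
    rw [hcb, lam]
    field_simp
    ring
  rw [hM, hN, melanSigma] at hle
  have hm : 0 < √B.stepM := Real.sqrt_pos.2 B.stepM_pos
  have hsq : B.stepM = √B.stepM ^ 2 := (Real.sq_sqrt B.stepM_pos.le).symm
  unfold StepCond
  have hNpos := B.stepN_pos
  set m := √B.stepM with hmdef
  set D := 6 * (m * B.L) * Real.cosh (m * B.L) + 6 * (m * B.L) - 12 * Real.sinh (m * B.L)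
    - (m * B.L) ^ 3 with hD
  have e : 4 * B.stepM / B.L ^ 3 * (3 * (m * B.L) ^ 3 / D) = 12 * m ^ 5 / D := by
    rw [hsq]; field_simp; ring
  rw [e] at hle
  -- No separate study of the denominator of `σ` is needed: `0 < N ≤ 12 m⁵ / D` already forces its
  -- sign.
  have hDpos : 0 < D := by
    have := hNpos.trans_le hle
    rwa [div_pos_iff_of_pos_left (by positivity)] at this
  rwa [le_div_iff₀ hDpos] at hle

end Bridge

/-! ### Assembly of the two monotone sequences -/

theorem theorem6p1 (B : Bridge) (n : ℝ) (hn : B.q / B.H = 8 * n / B.L)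
    (p : ℝ → ℝ) (hp_int : MeasureTheory.IntegrableOn p (Set.Icc 0 B.L))
    (hp_nonneg : ∀ᵐ x ∂(MeasureTheory.volume.restrict (Set.Ioo 0 B.L)), 0 ≤ p x)
    (hp_le : ∀ᵐ x ∂(MeasureTheory.volume.restrict (Set.Ioo 0 B.L)),
      p x ≤ (Real.pi ^ 4 / (100 * B.L ^ 3) * (B.E * B.I) + B.H * Real.pi ^ 2 / (100 * B.L)
            + B.q / B.H * (B.Ec * B.Ac / B.Lc) * (Real.pi * B.L / 5000))
              * Real.sin (Real.pi / B.L * x)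
          + 2 * (B.q / B.H) ^ 2 * (B.Ec * B.Ac / B.Lc) * (B.L ^ 2 / (100 * Real.pi))) :
    B.IsLowerSolution p (fun _ => 0) ∧ B.IsUpperSolution p B.beta ∧
    ∀ M N : ℝ, M = B.a + B.c * B.L ^ 3 / (400 * n * Real.pi) →
      N = B.c * (1 + Real.pi ^ 2 / (800 * n)) →
      1 / 15.32 ≤ n →
      N ≤ 4 * M / B.L ^ 3 * melanSigma (Real.sqrt M * B.L) →
      ¬ (∀ᵐ x ∂(MeasureTheory.volume.restrict (Set.Ioo 0 B.L)), p x = 0) →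
      ∃ (y : ℝ → ℝ) (α β : ℕ → ℝ → ℝ),
        -- `y` is the unique solution in the sector, and it is positive
        (B.IsSolution p y ∧ y ∈ sector B.L (fun _ => 0) B.beta ∧
          (∀ x ∈ Set.Ioo 0 B.L, 0 < y x) ∧
          ∀ z, B.IsSolution p z → z ∈ sector B.L (fun _ => 0) B.beta →
            Set.EqOn z y (Set.Icc 0 B.L)) ∧
        -- the two iterations are well defined
        B.IsTheIteration p (fun _ => 0) α ∧ B.IsTheIteration p B.beta β ∧
        -- they are monotone, together with their second derivatives
        (∀ k, ∀ x ∈ Set.Icc 0 B.L,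
          (α k x ≤ α (k + 1) x ∧ α k x ≤ β k x ∧ β (k + 1) x ≤ β k x) ∧
          (derivOn B.L 2 (α (k + 1)) x ≤ derivOn B.L 2 (α k) x ∧
            derivOn B.L 2 (β k) x ≤ derivOn B.L 2 (α k) x ∧
            derivOn B.L 2 (β k) x ≤ derivOn B.L 2 (β (k + 1)) x)) ∧
        -- both converge uniformly to `y`
        TendstoUniformlyOn α y Filter.atTop (Set.Icc 0 B.L) ∧
        TendstoUniformlyOn β y Filter.atTop (Set.Icc 0 B.L) := by
  have hl := Bridge.isLowerSolution_zero hp_nonneg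
  have hb := Bridge.isUpperSolution_beta hp_le
  refine ⟨hl, hb, ?_⟩
  rintro M N rfl rfl - hle hp
  have hc : B.StepCond := Bridge.stepCond_of_le hn hle
  obtain ⟨α, hα0, hα⟩ := Bridge.exists_isTheIteration hc hp_int (isW41_zero B.L)
  obtain ⟨β, hβ0, hβ⟩ := Bridge.exists_isTheIteration hc hp_int (Bridge.isW41_beta (B := B))
  have sα := hα.1.2
  have sβ := hβ.1.2
  have iα : ∀ k, Bridge.InSector B (α k) := by
    intro k
    induction k with
    | zero => rw [hα0]; exact Bridge.inSector_zero
    | succ k ih => exact hc.inSector_of_isStep hl hb ih (sα k)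
  have iβ : ∀ k, Bridge.InSector B (β k) := by
    intro k
    induction k with
    | zero => rw [hβ0]; exact Bridge.inSector_beta
    | succ k ih => exact hc.inSector_of_isStep hl hb ih (sβ k)
  have mα : ∀ k, SectorLE B.L (α k) (α (k + 1)) := by
    intro k
    induction k with
    | zero => rw [hα0]; exact (iα 1).zero_le
    | succ k ih => exact hc.isStep_mono (iα k) (iα (k + 1)) ih (sα k) (sα (k + 1))
  have mβ : ∀ k, SectorLE B.L (β (k + 1)) (β k) := by
    intro k
    induction k with
    | zero => rw [hβ0]; exact (iβ 1).le_beta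
    | succ k ih => exact hc.isStep_mono (iβ (k + 1)) (iβ k) ih (sβ (k + 1)) (sβ k)
  have mαβ : ∀ k, SectorLE B.L (α k) (β k) := by
    intro k
    induction k with
    | zero => rw [hα0, hβ0]; exact Bridge.sectorLE_zero_beta
    | succ k ih => exact hc.isStep_mono (iα k) (iβ k) ih (sα k) (sβ k)
  -- Along `α` the second derivatives decrease and are bounded below by `-λ π² / L²`; along `β` they
  -- increase and are bounded above by `0`.
  obtain ⟨y, hy, iy, ty⟩ := Bridge.exists_solution_of_tendsto hp_int sα iα fun x hx =>
    ⟨_, tendsto_atTop_ciInf (antitone_nat_of_succ_le fun k => (mα k x hx).2)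
      ⟨_, forall_mem_range.2 fun k => (iα k).le_derivOn_two hx⟩⟩
  obtain ⟨z, hz, iz, tz⟩ := Bridge.exists_solution_of_tendsto hp_int sβ iβ fun x hx =>
    ⟨_, tendsto_atTop_ciSup (monotone_nat_of_le_succ fun k => (mβ k x hx).2)
      ⟨_, forall_mem_range.2 fun k => (iβ k).derivOn_two_nonpos hx⟩⟩
  -- Uniqueness in the sector identifies the limit `z` of the upper sequence with `y`.
  exact ⟨y, α, β, ⟨hy, iy.mem_sector, hy.pos iy hp, fun w hw iw => hw.eqOn hy (hw.inSector iw) iy⟩,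
    hα, hβ, fun k x hx => ⟨⟨(mα k x hx).1, (mαβ k x hx).1, (mβ k x hx).1⟩,
      (mα k x hx).2, (mαβ k x hx).2, (mβ k x hx).2⟩, ty, tz.congr_right (hz.eqOn hy iz iy)⟩
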